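/- Let $K\subset\mathbb{R}^2$ be a polygonal domain, that is, a bounded connected open set whose boundary is a simple closed polygon with vertices $V_1,\dots,V_N$, $N\ge 3$, in cyclic order (straight angles, i.e. hanging nodes, are allowed), and let $h_K$ be its diameter. Let $\rho>0$ and suppose that $K$ satisfies the mesh assumptions with parameter $\rho$: $K$ is star-shaped with respect to every point of a ball of radius at least $\rho h_K$, and every edge of $K$ has length at least $\rho h_K$. Let $v\in H^2(K)$, let $|v|_{1,K}$ and $|v|_{2,K}$ be the $L^2(K)$ norms of its weak gradient and of its weak Hessian, and let the point values of $v$ on $\overline K$ be those of its representative that is continuous on $\overline K$. Then there is a constant $C_P>0$, depending only on $\rho$ (and not on $K$, $N$ or $v$), such that the following holds. 1. If $v(V_{i})=v(V_{i+1})=v(V_{i+2})$ for every three consecutive vertices $V_i,V_{i+1},V_{i+2}$ of $K$ that are not collinear, then $$|v|_{1,K}\le C_P\,h_K\,|v|_{2,K}.$$ 2. If $v(V_{i})=v(V_{i+1})=v(V_{i+2})$ for at least one triple of consecutive, non-collinear vertices (indices modulo $N$), and $\theta\in(0,\pi)$ denotes the angle at the middle vertex $V_{i+1}$ between the segments to $V_i$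 and to $V_{i+2}$, then $$|v|_{1,K}\le \frac{C_P}{\sqrt{1-|\cos\theta|}}\,h_K\,|v|_{2,K}.$$ -/

import Mathlib

open MeasureTheory Set
open scoped ContDiff

noncomputable section

/-- The Euclidean plane. -/
abbrev Plane : Type := EuclideanSpace ℝ (Fin 2)

namespace Plane

/-! ### Weak derivatives and Sobolev spaces on a subset of the plane -/

/-- `g` is the weak partial derivative `∂ᵢ u` on the open set `K`: both functions are locally
integrable on `K` and `∫_K u ∂ᵢφ = - ∫_K g φ` for every test function `φ ∈ C_c^∞(K)`. -/
def IsWeakPartial (K : Set Plane) (i : Fin 2) (u g : Plane → ℝ) : Prop :=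
  LocallyIntegrableOn u K ∧ LocallyIntegrableOn g K ∧
    ∀ φ : Plane → ℝ, ContDiff ℝ ∞ φ → HasCompactSupport φ → tsupport φ ⊆ K →
      ∫ x in K, u x * fderiv ℝ φ x (EuclideanSpace.single i 1) = -∫ x in K, g x * φ x

/-- The Sobolev space `H^m(K)`: `u ∈ L²(K)`, and all weak derivatives of `u` up to order `m`
exist and belong to `L²(K)`. -/
def MemH (K : Set Plane) : ℕ → (Plane → ℝ) → Prop
  | 0, u => MemLp u 2 (volume.restrict K)
  | m + 1, u => MemLp u 2 (volume.restrict K) ∧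
      ∀ i : Fin 2, ∃ g : Plane → ℝ, IsWeakPartial K i u g ∧ MemH K m g

open Classical in
/-- The weak partial derivative `∂ᵢ u` on `K` (unique up to equality almost everywhere in `K`),
and `0` if `u` has none. -/
def weakPartial (K : Set Plane) (i : Fin 2) (u : Plane → ℝ) : Plane → ℝ :=
  if h : ∃ g : Plane → ℝ, IsWeakPartial K i u g then h.choose else 0

/-- The seminorm `|u|_{1,K}`, the `L²(K)` norm of the weak gradient. -/
def seminormH1 (K : Set Plane) (u : Plane → ℝ) : ℝ :=
  √(∑ i : Fin 2, ∫ x in K, weakPartial K i u x ^ 2)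

/-- The seminorm `|u|_{2,K}`, the `L²(K)` norm of the weak Hessian. -/
def seminormH2 (K : Set Plane) (u : Plane → ℝ) : ℝ :=
  √(∑ i : Fin 2, ∑ j : Fin 2, ∫ x in K, weakPartial K j (weakPartial K i u) x ^ 2)

/-- `w` is a representative of the class of `u` on `K` that is continuous up to the boundary.
The point values of `u` on the closure of `K` are those of `w`. -/
def IsContinuousRep (K : Set Plane) (u w : Plane → ℝ) : Prop :=
  ContinuousOn w (closure K) ∧ w =ᵐ[volume.restrict K] u

/-! ### Polygonal domains -/

/-- A closed polygonal path with at least three vertices that is simple: edges are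
nondegenerate, consecutive edges meet only in their common vertex, and other pairs of edges are
disjoint. A vertex with a straight angle (a hanging node) is allowed. -/
structure IsSimplePolygon {n : ℕ} (P : Polygon Plane n) : Prop where
  three_le : 3 ≤ n
  nondegenerate : P.HasNondegenerateEdges
  consecutive : ∀ i : Fin n,
    P.edgeSet ℝ i ∩ P.edgeSet ℝ (finRotate n i) = {P (finRotate n i)}
  disjoint : ∀ i j : Fin n, j ≠ i → j ≠ finRotate n i → i ≠ finRotate n j →
    Disjoint (P.edgeSet ℝ i) (P.edgeSet ℝ j)

/-- `K` is the (open) polygonal domain bounded by the simple polygon `P`. -/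
structure IsPolygonalDomain {n : ℕ} (P : Polygon Plane n) (K : Set Plane) : Prop where
  simple : IsSimplePolygon P
  isOpen : IsOpen K
  isConnected : IsConnected K
  isBounded : Bornology.IsBounded K
  frontier_eq : frontier K = P.boundary ℝ

/-- The mesh assumptions with parameter `ρ` on a polygonal domain `K` bounded by `P`, where
`h_K` is the diameter of `K`: `K` is star-shaped with respect to every point of a ball of radius
at least `ρ h_K`, and every edge has length at least `ρ h_K`. -/
structure IsMeshRegular {n : ℕ} (ρ : ℝ) (P : Polygon Plane n) (K : Set Plane) : Prop where
  starShaped : ∃ (x₀ : Plane) (r : ℝ), ρ * Metric.diam K ≤ r ∧ Metric.ball x₀ r ⊆ K ∧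
    ∀ y ∈ Metric.ball x₀ r, StarConvex ℝ y K
  edge_length : ∀ i : Fin n, ρ * Metric.diam K ≤ dist (P i) (P (finRotate n i))

/-- The consecutive vertices `V_i, V_{i+1}, V_{i+2}` (cyclic numbering) are not collinear. -/
def NoncollinearAt {n : ℕ} (P : Polygon Plane n) (i : Fin n) : Prop :=
  ¬ Collinear ℝ {P i, P (finRotate n i), P (finRotate n (finRotate n i))}

/-- The function `w` takes the same value at `V_i, V_{i+1}, V_{i+2}` (cyclic numbering). -/
def EqualValuesAt {n : ℕ} (P : Polygon Plane n) (w : Plane → ℝ) (i : Fin n) : Prop :=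
  w (P i) = w (P (finRotate n i)) ∧
    w (P (finRotate n i)) = w (P (finRotate n (finRotate n i)))

/-- The angle at the middle vertex `V_{i+1}` between the edges to `V_i` and to `V_{i+2}`. -/
def angleAt {n : ℕ} (P : Polygon Plane n) (i : Fin n) : ℝ :=
  EuclideanGeometry.angle (P i) (P (finRotate n i)) (P (finRotate n (finRotate n i)))

end Plane

end

/-! The Hessian controls how far the gradient is from constant, and equal values at the ends of two
transversal edges force that constant to be small. Neither a trace theorem nor a compactness
argument is used, so the constants are explicit.

Let `u` be smooth, `S` star-shaped with respect to each point of `B`, and `h` a bound for the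
diameter. Integrating the Hessian along segments from `y ∈ B` to `x ∈ S` bounds the oscillation of
the gradient over `S × B` (`lintegral_lintegral_gradient_sub_le`). Taylor's formula at base point
`y`, evaluated at the ends of an edge, gives the derivative of `u` at `y` along that edge up to the
increment of `u` and two remainders, whose `L²(B)` norms the Hessian bounds
(`lintegral_remainder_le`). Two directions determine the gradient with the loss `1 - |cos|`
(`mul_gradSq_le`); together these give `gradient_estimate`.

For `v ∈ H²(K)` the estimate is applied to mollifications on homothetic copies of the closure of
`K`, which are compact in `K`. Fatou's lemma removes first the mollification
(`weak_gradient_estimate`), then the shrinking (`mul_seminormH1_sq_le`); the increments vanish in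
the limit because the representative is continuous up to the boundary.

Part 2 uses the two edges at the given vertex. For part 1, lines through boundary edges miss the
ball, so every direction meets some edge at an angle with sine at least `ρ`
(`exists_transversal_edge`). Hanging nodes are harmless: each edge is parallel to one that begins a
non-collinear triple (`exists_noncollinearAt_parallel`). -/

namespace Plane

/-! ### Calculus along segments -/

/-- The classical partial derivative `∂ᵢ u`. -/
noncomputable def classicalPartial (i : Fin 2) (u : Plane → ℝ) (x : Plane) : ℝ :=
  fderiv ℝ u x (EuclideanSpace.single i 1)

/-- The squared Euclidean norm of the classical gradient. -/
noncomputable def gradSq (u : Plane → ℝ) (x : Plane) : ℝ :=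
  ∑ i : Fin 2, classicalPartial i u x ^ 2

/-- The squared Frobenius norm of the classical Hessian. -/
noncomputable def hessSq (u : Plane → ℝ) (x : Plane) : ℝ :=
  ∑ i : Fin 2, gradSq (classicalPartial i u) x

lemma gradSq_nonneg (u : Plane → ℝ) (x : Plane) : 0 ≤ gradSq u x :=
  Finset.sum_nonneg fun _ _ => sq_nonneg _

lemma hessSq_nonneg (u : Plane → ℝ) (x : Plane) : 0 ≤ hessSq u x :=
  Finset.sum_nonneg fun _ _ => gradSq_nonneg _ _

lemma contDiff_classicalPartial {u : Plane → ℝ} (hu : ContDiff ℝ ∞ u) (i : Fin 2) :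
    ContDiff ℝ ∞ (classicalPartial i u) :=
  (hu.fderiv_right (m := ∞) (by simp)).clm_apply contDiff_const

lemma continuous_gradSq {u : Plane → ℝ} (hu : ContDiff ℝ ∞ u) : Continuous (gradSq u) :=
  continuous_finsetSum _ fun i _ => (contDiff_classicalPartial hu i).continuous.pow 2

lemma continuous_hessSq {u : Plane → ℝ} (hu : ContDiff ℝ ∞ u) : Continuous (hessSq u) :=
  continuous_finsetSum _ fun i _ => continuous_gradSq (contDiff_classicalPartial hu i)

lemma norm_sq_eq (d : Plane) : ‖d‖ ^ 2 = d 0 ^ 2 + d 1 ^ 2 := by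
  simp [EuclideanSpace.norm_sq_eq]

lemma fderiv_apply_eq (u : Plane → ℝ) (x d : Plane) :
    fderiv ℝ u x d = d 0 * classicalPartial 0 u x + d 1 * classicalPartial 1 u x := by
  have : d = d 0 • EuclideanSpace.single 0 (1 : ℝ) + d 1 • EuclideanSpace.single 1 (1 : ℝ) := by
    ext i; fin_cases i <;> simp
  conv_lhs => rw [this]
  simp [classicalPartial]

lemma sq_fderiv_apply_le (u : Plane → ℝ) (x d : Plane) :
    fderiv ℝ u x d ^ 2 ≤ ‖d‖ ^ 2 * gradSq u x := by
  rw [fderiv_apply_eq, norm_sq_eq, gradSq, Fin.sum_univ_two]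
  nlinarith [sq_nonneg (d 0 * classicalPartial 1 u x - d 1 * classicalPartial 0 u x)]

lemma hasDerivAt_segment {u : Plane → ℝ} (hu : ContDiff ℝ ∞ u) (y d : Plane) (s : ℝ) :
    HasDerivAt (fun s : ℝ => u (y + s • d)) (fderiv ℝ u (y + s • d) d) s := by
  have h1 : HasDerivAt (fun s : ℝ => y + s • d) d s := by
    simpa using ((hasDerivAt_id s).smul_const d).const_add y
  exact ((hu.differentiable (by simp)) _).hasFDerivAt.comp_hasDerivAt s h1

lemma continuous_fderiv_segment {u : Plane → ℝ} (hu : ContDiff ℝ ∞ u) (y d : Plane) :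
    Continuous fun s : ℝ => fderiv ℝ u (y + s • d) d :=
  ((hu.continuous_fderiv (by simp)).comp (by fun_prop)).clm_apply continuous_const

lemma sub_eq_integral {u : Plane → ℝ} (hu : ContDiff ℝ ∞ u) (x y : Plane) :
    u x - u y = ∫ s in (0 : ℝ)..1, fderiv ℝ u (y + s • (x - y)) (x - y) := by
  rw [intervalIntegral.integral_eq_sub_of_hasDerivAt
    (fun s _ => hasDerivAt_segment hu y (x - y) s)
    ((continuous_fderiv_segment hu y (x - y)).intervalIntegrable _ _)]
  simp

/-- The second derivative of `u` at `z` in direction `d`. -/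
noncomputable def secondDeriv (u : Plane → ℝ) (z d : Plane) : ℝ :=
  d 0 * fderiv ℝ (classicalPartial 0 u) z d + d 1 * fderiv ℝ (classicalPartial 1 u) z d

lemma sq_secondDeriv_le (u : Plane → ℝ) (z d : Plane) :
    secondDeriv u z d ^ 2 ≤ (‖d‖ ^ 2) ^ 2 * hessSq u z := by
  have h0 := sq_fderiv_apply_le (classicalPartial 0 u) z d
  have h1 := sq_fderiv_apply_le (classicalPartial 1 u) z d
  set a := fderiv ℝ (classicalPartial 0 u) z d
  set b := fderiv ℝ (classicalPartial 1 u) z d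
  have h2 : secondDeriv u z d ^ 2 ≤ ‖d‖ ^ 2 * (a ^ 2 + b ^ 2) := by
    rw [norm_sq_eq, secondDeriv]
    nlinarith [sq_nonneg (d 0 * b - d 1 * a)]
  refine h2.trans ?_
  rw [hessSq, Fin.sum_univ_two, pow_two (‖d‖ ^ 2), mul_assoc]
  gcongr
  linarith

lemma continuous_secondDeriv_segment {u : Plane → ℝ} (hu : ContDiff ℝ ∞ u) (y d : Plane) :
    Continuous fun s : ℝ => secondDeriv u (y + s • d) d :=
  (continuous_const.mul (continuous_fderiv_segment (contDiff_classicalPartial hu 0) y d)).add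
    (continuous_const.mul (continuous_fderiv_segment (contDiff_classicalPartial hu 1) y d))

/-- Taylor's formula of order one with integral remainder. -/
lemma taylor_integral {u : Plane → ℝ} (hu : ContDiff ℝ ∞ u) (x y : Plane) :
    u x - u y - fderiv ℝ u y (x - y) =
      ∫ s in (0 : ℝ)..1, (1 - s) * secondDeriv u (y + s • (x - y)) (x - y) := by
  set d := x - y with hd
  have h2 : ∀ s : ℝ, HasDerivAt (fun s : ℝ => fderiv ℝ u (y + s • d) d)
      (secondDeriv u (y + s • d) d) s := by
    intro s
    simp_rw [fderiv_apply_eq u]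
    exact ((hasDerivAt_segment (contDiff_classicalPartial hu 0) y d s).const_mul _).add
      ((hasDerivAt_segment (contDiff_classicalPartial hu 1) y d s).const_mul _)
  -- In this primitive the first-order terms cancel on differentiation, which replaces an
  -- integration by parts.
  have h3 : ∀ s : ℝ, HasDerivAt
      (fun s : ℝ => u (y + s • d) + (1 - s) * fderiv ℝ u (y + s • d) d)
      ((1 - s) * secondDeriv u (y + s • d) d) s := by
    intro s
    have := (hasDerivAt_segment hu y d s).add (((hasDerivAt_id s).const_sub 1).mul (h2 s))
    refine HasDerivAt.congr_deriv this ?_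
    simp only [id]
    ring
  rw [intervalIntegral.integral_eq_sub_of_hasDerivAt (fun s _ => h3 s)
    ((((continuous_const.sub continuous_id).mul
      (continuous_secondDeriv_segment hu y d))).intervalIntegrable _ _)]
  simp [hd]
  ring

/-! ### Jensen's inequality for the square -/

/-- This is nonnegativity of the variance when `g ∈ L²`; otherwise the right side is infinite, so no
integrability is assumed. -/
lemma ofReal_sq_integral_le {α : Type*} {m : MeasurableSpace α} {μ : Measure α}
    [IsProbabilityMeasure μ] {g : α → ℝ} (hg : AEStronglyMeasurable g μ) :
    ENNReal.ofReal ((∫ a, g a ∂μ) ^ 2) ≤ ∫⁻ a, ENNReal.ofReal (g a ^ 2) ∂μ := by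
  by_cases h : MemLp g 2 μ
  · have h1 : Integrable (fun a => g a ^ 2) μ := h.integrable_sq
    rw [← ofReal_integral_eq_lintegral_ofReal h1 (ae_of_all _ fun a => sq_nonneg _)]
    apply ENNReal.ofReal_le_ofReal
    have h2 := ProbabilityTheory.variance_nonneg g μ
    rw [ProbabilityTheory.variance_eq_sub h] at h2
    simpa using h2
  · have : ∫⁻ a, ENNReal.ofReal (g a ^ 2) ∂μ = ⊤ := by
      by_contra hne
      refine h ((memLp_two_iff_integrable_sq hg).2 ⟨hg.pow 2, ?_⟩)
      rw [hasFiniteIntegral_iff_ofReal (ae_of_all _ fun a => sq_nonneg _)]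
      exact lt_top_iff_ne_top.2 hne
    simp [this]

lemma ofReal_sq_intervalIntegral_le {g : ℝ → ℝ} (hg : Continuous g) :
    ENNReal.ofReal ((∫ s in (0 : ℝ)..1, g s) ^ 2) ≤
      ∫⁻ s in Ioo (0 : ℝ) 1, ENNReal.ofReal (g s ^ 2) := by
  have : IsProbabilityMeasure (volume.restrict (Ioo (0 : ℝ) 1)) := ⟨by simp⟩
  rw [intervalIntegral.integral_of_le zero_le_one, integral_Ioc_eq_integral_Ioo]
  exact ofReal_sq_integral_le hg.aestronglyMeasurable

lemma ofReal_sq_sub_le {u : Plane → ℝ} (hu : ContDiff ℝ ∞ u) (x y : Plane) :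
    ENNReal.ofReal ((u x - u y) ^ 2) ≤
      ∫⁻ s in Ioo (0 : ℝ) 1, ENNReal.ofReal (‖x - y‖ ^ 2 * gradSq u (y + s • (x - y))) := by
  rw [sub_eq_integral hu]
  exact (ofReal_sq_intervalIntegral_le (continuous_fderiv_segment hu y (x - y))).trans
    (lintegral_mono fun s => ENNReal.ofReal_le_ofReal (sq_fderiv_apply_le _ _ _))

lemma ofReal_sq_remainder_le {u : Plane → ℝ} (hu : ContDiff ℝ ∞ u) (x y : Plane) :
    ENNReal.ofReal ((u x - u y - fderiv ℝ u y (x - y)) ^ 2) ≤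
      ∫⁻ s in Ioo (0 : ℝ) 1,
        ENNReal.ofReal ((‖x - y‖ ^ 2) ^ 2 * ((1 - s) ^ 2 * hessSq u (y + s • (x - y)))) := by
  rw [taylor_integral hu]
  refine (ofReal_sq_intervalIntegral_le ((continuous_const.sub continuous_id).mul
    (continuous_secondDeriv_segment hu y (x - y)))).trans
    (lintegral_mono fun s => ENNReal.ofReal_le_ofReal ?_)
  change ((1 - s) * secondDeriv u (y + s • (x - y)) (x - y)) ^ 2 ≤ _
  rw [mul_pow, mul_left_comm]
  exact mul_le_mul_of_nonneg_left (sq_secondDeriv_le _ _ _) (sq_nonneg _)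

/-! ### Integrals over segments in star-shaped sets -/

lemma lintegral_comp_affine (F : Plane → ENNReal) (hF : Measurable F) {c : ℝ} (hc : c ≠ 0)
    (b : Plane) :
    ∫⁻ y, F (c • y + b) = ENNReal.ofReal ((c ^ 2)⁻¹) * ∫⁻ z, F z := by
  rw [lintegral_add_right_eq_self (fun y => F (c • y + b)) 0 |>.symm]
  have h1 : ∫⁻ y, F (c • y + b) = ∫⁻ y, (fun z => F (z + b)) (c • y) := rfl
  have h2 : ∫⁻ y, (fun z => F (z + b)) (c • y) =
      ∫⁻ z, F (z + b) ∂(Measure.map (c • ·) (volume : Measure Plane)) :=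
    (lintegral_map (f := fun z => F (z + b)) (hF.comp (measurable_add_const b))
      (measurable_const_smul c)).symm
  simp only [add_zero]
  rw [h1, h2, Measure.map_addHaar_smul _ hc, lintegral_smul_measure,
    lintegral_add_right_eq_self F b]
  simp

lemma setLIntegral_comp_affine_le {S T : Set Plane} (hS : MeasurableSet S) (hT : MeasurableSet T)
    {F : Plane → ENNReal} (hF : Measurable F) {c : ℝ} (hc : c ≠ 0) (b : Plane)
    (h : ∀ z ∈ T, c • z + b ∈ S) :
    ∫⁻ z in T, F (c • z + b) ≤ ENNReal.ofReal ((c ^ 2)⁻¹) * ∫⁻ z in S, F z := by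
  rw [← lintegral_indicator hS, ← lintegral_comp_affine _ (hF.indicator hS) hc b]
  calc ∫⁻ z in T, F (c • z + b) = ∫⁻ z in T, S.indicator F (c • z + b) :=
        setLIntegral_congr_fun hT fun z hz => by simp [h z hz]
    _ ≤ _ := setLIntegral_le_lintegral _ _

section StarShaped

variable {S B : Set Plane}

lemma segment_mem (hB : ∀ y ∈ B, StarConvex ℝ y S) {x y : Plane} (hx : x ∈ S) (hy : y ∈ B)
    {s : ℝ} (hs : s ∈ Ioo (0 : ℝ) 1) : y + s • (x - y) ∈ S :=
  (hB y hy).add_smul_sub_mem hx hs.1.le hs.2.le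

/-- For fixed `x` the map in `y` is a homothety of ratio `1 - s` into `S`; the factor is its inverse
Jacobian. -/
lemma setLIntegral_segment_left_le (hS : MeasurableSet S) (hBm : MeasurableSet B)
    (hB : ∀ y ∈ B, StarConvex ℝ y S) {F : Plane → ENNReal} (hF : Measurable F) {x : Plane}
    (hx : x ∈ S) {s : ℝ} (hs : s ∈ Ioo (0 : ℝ) 1) :
    ∫⁻ y in B, F (y + s • (x - y)) ≤ ENNReal.ofReal (((1 - s) ^ 2)⁻¹) * ∫⁻ z in S, F z := by
  have he : ∀ y : Plane, y + s • (x - y) = (1 - s) • y + s • x := fun y => by module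
  have := setLIntegral_comp_affine_le hS hBm hF (sub_ne_zero.2 hs.2.ne') (s • x)
    (fun y hy => he y ▸ segment_mem hB hx hy hs)
  simpa only [he] using this

lemma setLIntegral_segment_right_le (hS : MeasurableSet S)
    (hB : ∀ y ∈ B, StarConvex ℝ y S) {F : Plane → ENNReal} (hF : Measurable F) {y : Plane}
    (hy : y ∈ B) {s : ℝ} (hs : s ∈ Ioo (0 : ℝ) 1) :
    ∫⁻ x in S, F (y + s • (x - y)) ≤ ENNReal.ofReal ((s ^ 2)⁻¹) * ∫⁻ z in S, F z := by
  have he : ∀ x : Plane, y + s • (x - y) = s • x + (y - s • y) := fun x => by module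
  have := setLIntegral_comp_affine_le hS hS hF hs.1.ne' (y - s • y)
    (fun x hx => he x ▸ segment_mem hB hx hy hs)
  simpa only [he] using this

/-- The change of variables in `y` degenerates as `s → 1`, the one in `x` as `s → 0`. Using the
first for `s ≤ 1/2` and the second for `s ≥ 1/2` keeps the inverse Jacobian at most 4. -/
lemma setLIntegral_setLIntegral_segment_le (hS : MeasurableSet S) (hBm : MeasurableSet B)
    (hBS : B ⊆ S) (hB : ∀ y ∈ B, StarConvex ℝ y S) {F : Plane → ENNReal} (hF : Measurable F)
    {s : ℝ} (hs : s ∈ Ioo (0 : ℝ) 1) :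
    ∫⁻ x in S, ∫⁻ y in B, F (y + s • (x - y)) ≤ 4 * (∫⁻ z in S, F z) * volume S := by
  have hbound : ∀ t : ℝ, 1 / 2 ≤ t → ENNReal.ofReal ((t ^ 2)⁻¹) ≤ 4 := by
    intro t ht
    rw [← ENNReal.ofReal_ofNat 4]
    apply ENNReal.ofReal_le_ofReal
    rw [inv_le_comm₀ (by positivity) (by norm_num)]
    nlinarith
  rcases le_total s (1 / 2) with h | h
  · calc ∫⁻ x in S, ∫⁻ y in B, F (y + s • (x - y))
        ≤ ∫⁻ _ in S, 4 * ∫⁻ z in S, F z := by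
          refine setLIntegral_mono' hS fun x hx =>
            (setLIntegral_segment_left_le hS hBm hB hF hx hs).trans ?_
          gcongr
          exact hbound _ (by linarith)
      _ = _ := by rw [setLIntegral_const]
  · rw [lintegral_lintegral_swap]
    · calc ∫⁻ y in B, ∫⁻ x in S, F (y + s • (x - y))
          ≤ ∫⁻ _ in B, 4 * ∫⁻ z in S, F z := by
            refine setLIntegral_mono' hBm fun y hy =>
              (setLIntegral_segment_right_le hS hB hF hy hs).trans ?_
            gcongr
            exact hbound _ h
        _ ≤ _ := by rw [setLIntegral_const]; gcongr
    · exact (hF.comp (by fun_prop : Measurable fun p : Plane × Plane =>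
        p.2 + s • (p.1 - p.2))).aemeasurable

lemma lintegral_segment_swap (S B : Set Plane) {F : Plane → ENNReal} (hF : Measurable F) :
    ∫⁻ x in S, ∫⁻ y in B, ∫⁻ s in Ioo (0 : ℝ) 1, F (y + s • (x - y)) =
      ∫⁻ s in Ioo (0 : ℝ) 1, ∫⁻ x in S, ∫⁻ y in B, F (y + s • (x - y)) := by
  have h1 : Measurable fun q : (Plane × ℝ) × Plane => F (q.2 + q.1.2 • (q.1.1 - q.2)) :=
    hF.comp (by fun_prop)
  have h2 : Measurable fun q : Plane × ℝ => ∫⁻ y in B, F (y + q.2 • (q.1 - y)) :=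
    h1.lintegral_prod_right'
  have h3 : ∀ x : Plane, Measurable fun q : Plane × ℝ => F (q.1 + q.2 • (x - q.1)) := fun x =>
    hF.comp (by fun_prop)
  rw [← lintegral_lintegral_swap (f := fun x s => ∫⁻ y in B, F (y + s • (x - y))) h2.aemeasurable]
  refine lintegral_congr fun x => ?_
  exact lintegral_lintegral_swap (f := fun y s => F (y + s • (x - y))) (h3 x).aemeasurable

/-- The double integral of the squared oscillation of the gradient is controlled by the Hessian. -/
lemma lintegral_lintegral_gradient_sub_le (hS : MeasurableSet S) (hBm : MeasurableSet B)
    (hBS : B ⊆ S) (hB : ∀ y ∈ B, StarConvex ℝ y S) {h : ℝ}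
    (hd : ∀ x ∈ S, ∀ y ∈ S, ‖x - y‖ ≤ h) {u : Plane → ℝ} (hu : ContDiff ℝ ∞ u) :
    ∫⁻ x in S, ∫⁻ y in B,
        ENNReal.ofReal (∑ i, (classicalPartial i u x - classicalPartial i u y) ^ 2) ≤
      4 * (ENNReal.ofReal (h ^ 2) * ∫⁻ z in S, ENNReal.ofReal (hessSq u z)) * volume S := by
  set F : Plane → ENNReal := fun z => ENNReal.ofReal (h ^ 2) * ENNReal.ofReal (hessSq u z) with hFdef
  have hHm : Measurable fun z => ENNReal.ofReal (hessSq u z) :=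
    (continuous_hessSq hu).measurable.ennreal_ofReal
  have hF : Measurable F := hHm.const_mul _
  have hpt : ∀ x ∈ S, ∀ y ∈ B,
      ENNReal.ofReal (∑ i, (classicalPartial i u x - classicalPartial i u y) ^ 2) ≤
        ∫⁻ s in Ioo (0 : ℝ) 1, F (y + s • (x - y)) := by
    intro x hx y hy
    have hxy : ‖x - y‖ ^ 2 ≤ h ^ 2 := pow_le_pow_left₀ (norm_nonneg _) (hd x hx y (hBS hy)) 2
    rw [ENNReal.ofReal_sum_of_nonneg fun _ _ => sq_nonneg _]
    calc ∑ i, ENNReal.ofReal ((classicalPartial i u x - classicalPartial i u y) ^ 2)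
        ≤ ∑ i, ∫⁻ s in Ioo (0 : ℝ) 1, ENNReal.ofReal (h ^ 2) *
            ENNReal.ofReal (gradSq (classicalPartial i u) (y + s • (x - y))) := by
          refine Finset.sum_le_sum fun i _ =>
            (ofReal_sq_sub_le (contDiff_classicalPartial hu i) x y).trans
              (lintegral_mono fun s => ?_)
          rw [← ENNReal.ofReal_mul (sq_nonneg _)]
          exact ENNReal.ofReal_le_ofReal (mul_le_mul_of_nonneg_right hxy (gradSq_nonneg _ _))
      _ = ∫⁻ s in Ioo (0 : ℝ) 1, F (y + s • (x - y)) := by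
          rw [← lintegral_finsetSum]
          · refine lintegral_congr fun s => ?_
            simp only [hFdef, hessSq]
            rw [← Finset.mul_sum, ENNReal.ofReal_sum_of_nonneg fun _ _ => gradSq_nonneg _ _]
          · intro i _
            refine Measurable.const_mul (Continuous.measurable ?_).ennreal_ofReal _
            exact (continuous_gradSq (contDiff_classicalPartial hu i)).comp (by fun_prop)
  calc ∫⁻ x in S, ∫⁻ y in B,
        ENNReal.ofReal (∑ i, (classicalPartial i u x - classicalPartial i u y) ^ 2)
      ≤ ∫⁻ x in S, ∫⁻ y in B, ∫⁻ s in Ioo (0 : ℝ) 1, F (y + s • (x - y)) :=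
        setLIntegral_mono' hS fun x hx => setLIntegral_mono' hBm fun y hy => hpt x hx y hy
    _ = ∫⁻ s in Ioo (0 : ℝ) 1, ∫⁻ x in S, ∫⁻ y in B, F (y + s • (x - y)) :=
        lintegral_segment_swap S B hF
    _ ≤ ∫⁻ _ in Ioo (0 : ℝ) 1, 4 * (∫⁻ z in S, F z) * volume S :=
        setLIntegral_mono' measurableSet_Ioo fun s hs =>
          setLIntegral_setLIntegral_segment_le hS hBm hBS hB hF hs
    _ = _ := by
        rw [setLIntegral_const, hFdef, lintegral_const_mul _ hHm]
        simp

/-- The Taylor remainder at a fixed point, as a function of the base point, is controlled in `L²`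
by the Hessian. -/
lemma lintegral_remainder_le (hS : MeasurableSet S) (hBm : MeasurableSet B)
    (hBS : B ⊆ S) (hB : ∀ y ∈ B, StarConvex ℝ y S) {h : ℝ}
    (hd : ∀ x ∈ S, ∀ y ∈ S, ‖x - y‖ ≤ h) {u : Plane → ℝ} (hu : ContDiff ℝ ∞ u) {x : Plane}
    (hx : x ∈ S) :
    ∫⁻ y in B, ENNReal.ofReal ((u x - u y - fderiv ℝ u y (x - y)) ^ 2) ≤
      ENNReal.ofReal (h ^ 4) * ∫⁻ z in S, ENNReal.ofReal (hessSq u z) := by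
  have hHm : Measurable fun z => ENNReal.ofReal (hessSq u z) :=
    (continuous_hessSq hu).measurable.ennreal_ofReal
  calc ∫⁻ y in B, ENNReal.ofReal ((u x - u y - fderiv ℝ u y (x - y)) ^ 2)
      ≤ ∫⁻ y in B, ∫⁻ s in Ioo (0 : ℝ) 1, ENNReal.ofReal (h ^ 4) *
          (ENNReal.ofReal ((1 - s) ^ 2) * ENNReal.ofReal (hessSq u (y + s • (x - y)))) := by
        refine setLIntegral_mono' hBm fun y hy => (ofReal_sq_remainder_le hu x y).trans
          (lintegral_mono fun s => ?_)
        rw [← ENNReal.ofReal_mul (sq_nonneg _), ← ENNReal.ofReal_mul (by positivity)]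
        refine ENNReal.ofReal_le_ofReal (mul_le_mul_of_nonneg_right ?_
          (mul_nonneg (sq_nonneg _) (hessSq_nonneg _ _)))
        rw [← pow_mul]
        exact pow_le_pow_left₀ (norm_nonneg _) (hd x hx y (hBS hy)) 4
    _ = ∫⁻ s in Ioo (0 : ℝ) 1, ∫⁻ y in B, ENNReal.ofReal (h ^ 4) *
          (ENNReal.ofReal ((1 - s) ^ 2) * ENNReal.ofReal (hessSq u (y + s • (x - y)))) := by
        rw [lintegral_lintegral_swap]
        have h1 : Measurable fun p : Plane × ℝ => ENNReal.ofReal ((1 - p.2) ^ 2) := by fun_prop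
        have h2 : Measurable fun p : Plane × ℝ =>
            ENNReal.ofReal (hessSq u (p.1 + p.2 • (x - p.1))) := hHm.comp (by fun_prop)
        exact ((h1.mul h2).const_mul _).aemeasurable
    _ ≤ ∫⁻ _ in Ioo (0 : ℝ) 1, ENNReal.ofReal (h ^ 4) *
          ∫⁻ z in S, ENNReal.ofReal (hessSq u z) := by
        refine setLIntegral_mono' measurableSet_Ioo fun s hs => ?_
        have hm : Measurable fun y => ENNReal.ofReal (hessSq u (y + s • (x - y))) :=
          hHm.comp (by fun_prop)
        rw [lintegral_const_mul _ (hm.const_mul _), lintegral_const_mul _ hm]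
        gcongr
        -- The weight `(1 - s)²` of the squared remainder exactly cancels the inverse Jacobian, so
        -- the bound holds at each single point `x`, without averaging over it.
        calc ENNReal.ofReal ((1 - s) ^ 2) * ∫⁻ y in B, ENNReal.ofReal (hessSq u (y + s • (x - y)))
            ≤ ENNReal.ofReal ((1 - s) ^ 2) * (ENNReal.ofReal (((1 - s) ^ 2)⁻¹) *
                ∫⁻ z in S, ENNReal.ofReal (hessSq u z)) := by
              gcongr
              exact setLIntegral_segment_left_le hS hBm hB hHm hx hs
          _ = _ := by
              have : (1 - s) ^ 2 ≠ 0 := pow_ne_zero _ (sub_ne_zero.2 hs.2.ne')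
              rw [← mul_assoc, ← ENNReal.ofReal_mul (sq_nonneg _), mul_inv_cancel₀ this]
              simp
    _ = _ := by rw [setLIntegral_const]; simp

end StarShaped

end Plane

namespace Plane

/-! ### The estimate for smooth functions -/

/-- The absolute value of the cosine of the angle between two vectors. -/
noncomputable def absCos (d e : Plane) : ℝ := |Real.cos (InnerProductGeometry.angle d e)|

lemma absCos_nonneg (d e : Plane) : 0 ≤ absCos d e := abs_nonneg _

lemma absCos_le_one (d e : Plane) : absCos d e ≤ 1 := Real.abs_cos_le_one _

lemma inner_eq (d e : Plane) : inner ℝ d e = d 0 * e 0 + d 1 * e 1 := by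
  simp [PiLp.inner_apply, mul_comm]

lemma mul_gradSq_le (u : Plane → ℝ) (y : Plane) {d e : Plane} {m : ℝ} (hm : 0 < m)
    (hd : m ≤ ‖d‖) (he : m ≤ ‖e‖) :
    (1 - absCos d e) * gradSq u y ≤
      1 / m ^ 2 * (fderiv ℝ u y d ^ 2 + fderiv ℝ u y e ^ 2) := by
  have hd0 : 0 < ‖d‖ := hm.trans_le hd
  have he0 : 0 < ‖e‖ := hm.trans_le he
  set X := fderiv ℝ u y d with hX
  set Y := fderiv ℝ u y e with hY
  set x := X / ‖d‖ with hx
  set z := Y / ‖e‖ with hz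
  set c := Real.cos (InnerProductGeometry.angle d e) with hc
  have hc' : c = inner ℝ d e / (‖d‖ * ‖e‖) := InnerProductGeometry.cos_angle d e
  have hgram : gradSq u y * (1 - c ^ 2) = x ^ 2 + z ^ 2 - 2 * c * x * z := by
    have h1 : gradSq u y * (‖d‖ ^ 2 * ‖e‖ ^ 2 - inner ℝ d e ^ 2) =
        X ^ 2 * ‖e‖ ^ 2 + Y ^ 2 * ‖d‖ ^ 2 - 2 * inner ℝ d e * X * Y := by
      rw [hX, hY, fderiv_apply_eq, fderiv_apply_eq, norm_sq_eq, norm_sq_eq, inner_eq, gradSq,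
        Fin.sum_univ_two]
      ring
    rw [hc', hx, hz]
    field_simp
    linear_combination h1
  have hle : (1 - absCos d e) * gradSq u y ≤ x ^ 2 + z ^ 2 := by
    have h0 : 0 ≤ |c| := abs_nonneg c
    have h1 : -(2 * c * x * z) ≤ |c| * (x ^ 2 + z ^ 2) := by
      rcases abs_cases c with ⟨h, _⟩ | ⟨h, _⟩ <;> rw [h] <;>
        nlinarith [sq_nonneg (x + z), sq_nonneg (x - z)]
    change (1 - |c|) * gradSq u y ≤ x ^ 2 + z ^ 2
    refine le_of_mul_le_mul_left ?_ (by linarith : 0 < 1 + |c|)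
    calc (1 + |c|) * ((1 - |c|) * gradSq u y) = gradSq u y * (1 - |c| ^ 2) := by ring
      _ = x ^ 2 + z ^ 2 - 2 * c * x * z := by rw [sq_abs, hgram]
      _ ≤ _ := by linarith
  have hxle : x ^ 2 ≤ 1 / m ^ 2 * X ^ 2 := by
    rw [hx, div_pow, div_eq_mul_one_div, mul_comm]
    gcongr
  have hzle : z ^ 2 ≤ 1 / m ^ 2 * Y ^ 2 := by
    rw [hz, div_pow, div_eq_mul_one_div, mul_comm]
    gcongr
  linarith

variable {S B : Set Plane}

/-- Subtracting the Taylor formulas at two points with the same base point `y` isolates the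
derivative at `y` along their difference. -/
lemma lintegral_mul_gradSq_le (hS : MeasurableSet S) (hBm : MeasurableSet B)
    (hBS : B ⊆ S) (hB : ∀ y ∈ B, StarConvex ℝ y S) {h : ℝ}
    (hd : ∀ x ∈ S, ∀ y ∈ S, ‖x - y‖ ≤ h) {u : Plane → ℝ} (hu : ContDiff ℝ ∞ u)
    {p : Fin 4 → Plane} (hp : ∀ k, p k ∈ S) {m : ℝ} (hm : 0 < m)
    (h01 : m ≤ ‖p 1 - p 0‖) (h23 : m ≤ ‖p 3 - p 2‖) :
    ∫⁻ y in B, ENNReal.ofReal ((1 - absCos (p 1 - p 0) (p 3 - p 2)) * gradSq u y) ≤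
      ENNReal.ofReal (3 / m ^ 2) *
        (ENNReal.ofReal ((u (p 1) - u (p 0)) ^ 2 + (u (p 3) - u (p 2)) ^ 2) * volume B +
          4 * (ENNReal.ofReal (h ^ 4) * ∫⁻ z in S, ENNReal.ofReal (hessSq u z))) := by
  set R : Fin 4 → Plane → ℝ := fun k y => u (p k) - u y - fderiv ℝ u y (p k - y) with hR
  set δ := (u (p 1) - u (p 0)) ^ 2 + (u (p 3) - u (p 2)) ^ 2 with hδ
  have hfd : Continuous (fderiv ℝ u) := hu.continuous_fderiv (by simp)
  have hRm : ∀ k, Measurable fun y => ENNReal.ofReal (R k y ^ 2) := fun k => by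
    refine (Continuous.measurable ?_).ennreal_ofReal
    exact ((continuous_const.sub hu.continuous).sub
      (hfd.clm_apply (continuous_const.sub continuous_id))).pow 2
  have hpt : ∀ y, (1 - absCos (p 1 - p 0) (p 3 - p 2)) * gradSq u y ≤
      3 / m ^ 2 * (δ + ∑ k, R k y ^ 2) := by
    intro y
    refine (mul_gradSq_le u y hm h01 h23).trans ?_
    have e1 : fderiv ℝ u y (p 1 - p 0) = (u (p 1) - u (p 0)) - R 1 y + R 0 y := by
      rw [show p 1 - p 0 = (p 1 - y) - (p 0 - y) by abel, map_sub]
      simp only [hR]; ring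
    have e2 : fderiv ℝ u y (p 3 - p 2) = (u (p 3) - u (p 2)) - R 3 y + R 2 y := by
      rw [show p 3 - p 2 = (p 3 - y) - (p 2 - y) by abel, map_sub]
      simp only [hR]; ring
    have h3 : ∀ a b c : ℝ, (a - b + c) ^ 2 ≤ 3 * (a ^ 2 + c ^ 2 + b ^ 2) := fun a b c => by
      nlinarith [sq_nonneg (a + b), sq_nonneg (a - c), sq_nonneg (b + c)]
    rw [e1, e2, Fin.sum_univ_four, hδ, show (3 : ℝ) / m ^ 2 = 1 / m ^ 2 * 3 by ring, mul_assoc]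
    gcongr
    linarith [h3 (u (p 1) - u (p 0)) (R 1 y) (R 0 y), h3 (u (p 3) - u (p 2)) (R 3 y) (R 2 y)]
  calc ∫⁻ y in B, ENNReal.ofReal ((1 - absCos (p 1 - p 0) (p 3 - p 2)) * gradSq u y)
      ≤ ∫⁻ y in B, ENNReal.ofReal (3 / m ^ 2) *
          (ENNReal.ofReal δ + ∑ k, ENNReal.ofReal (R k y ^ 2)) := by
        refine lintegral_mono fun y => (ENNReal.ofReal_le_ofReal (hpt y)).trans_eq ?_
        rw [ENNReal.ofReal_mul (by positivity),
          ENNReal.ofReal_add (by positivity) (Finset.sum_nonneg fun _ _ => sq_nonneg _),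
          ENNReal.ofReal_sum_of_nonneg fun _ _ => sq_nonneg _]
    _ = ENNReal.ofReal (3 / m ^ 2) * (ENNReal.ofReal δ * volume B +
          ∑ k, ∫⁻ y in B, ENNReal.ofReal (R k y ^ 2)) := by
        rw [lintegral_const_mul _ (by fun_prop), lintegral_add_left measurable_const,
          setLIntegral_const, lintegral_finsetSum _ fun k _ => hRm k]
    _ ≤ _ := by
        gcongr
        calc ∑ k, ∫⁻ y in B, ENNReal.ofReal (R k y ^ 2)
            ≤ ∑ _k : Fin 4, ENNReal.ofReal (h ^ 4) * ∫⁻ z in S, ENNReal.ofReal (hessSq u z) :=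
              Finset.sum_le_sum fun k _ => lintegral_remainder_le hS hBm hBS hB hd hu (hp k)
          _ = _ := by simp

/-- The Poincaré inequality for smooth functions on a set that is star-shaped with respect to
every point of `B`, up to the increments of the function along two segments. -/
lemma gradient_estimate (hS : MeasurableSet S) (hBm : MeasurableSet B)
    (hBS : B ⊆ S) (hB : ∀ y ∈ B, StarConvex ℝ y S) {h : ℝ}
    (hd : ∀ x ∈ S, ∀ y ∈ S, ‖x - y‖ ≤ h) {u : Plane → ℝ} (hu : ContDiff ℝ ∞ u)
    {p : Fin 4 → Plane} (hp : ∀ k, p k ∈ S) {m : ℝ} (hm : 0 < m)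
    (h01 : m ≤ ‖p 1 - p 0‖) (h23 : m ≤ ‖p 3 - p 2‖) (hB0 : volume B ≠ 0) (hBt : volume B ≠ ⊤)
    {M : ENNReal} (hvol : volume S ≤ M * volume B) :
    ∫⁻ x in S, ENNReal.ofReal ((1 - absCos (p 1 - p 0) (p 3 - p 2)) * gradSq u x) ≤
      M * (ENNReal.ofReal (8 * h ^ 2 + 24 * h ^ 4 / m ^ 2) *
          (∫⁻ z in S, ENNReal.ofReal (hessSq u z)) +
        ENNReal.ofReal (6 / m ^ 2 * ((u (p 1) - u (p 0)) ^ 2 + (u (p 3) - u (p 2)) ^ 2)) *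
          volume B) := by
  set κ := 1 - absCos (p 1 - p 0) (p 3 - p 2) with hκ
  set δ := (u (p 1) - u (p 0)) ^ 2 + (u (p 3) - u (p 2)) ^ 2 with hδ
  set L := ∫⁻ z in S, ENNReal.ofReal (hessSq u z) with hL
  have hδ0 : 0 ≤ δ := by positivity
  have hκ0 : 0 ≤ κ := sub_nonneg.2 (absCos_le_one _ _)
  have hκ1 : κ ≤ 1 := by rw [hκ]; linarith [absCos_nonneg (p 1 - p 0) (p 3 - p 2)]
  set G : Plane → Plane → ℝ := fun x y =>
    ∑ i, (classicalPartial i u x - classicalPartial i u y) ^ 2 with hG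
  have hG0 : ∀ x y, 0 ≤ G x y := fun x y => Finset.sum_nonneg fun _ _ => sq_nonneg _
  have hgm : Measurable fun y => ENNReal.ofReal (κ * gradSq u y) :=
    ((continuous_gradSq hu).measurable.const_mul κ).ennreal_ofReal
  -- The gradient at `x` is compared with that at `y`; `κ ≤ 1` is dropped from the oscillation but
  -- kept on the gradient at `y`, where it is needed.
  have hpt : ∀ x y, ENNReal.ofReal (κ * gradSq u x) ≤
      2 * ENNReal.ofReal (G x y) + 2 * ENNReal.ofReal (κ * gradSq u y) := by
    intro x y
    have h1 : gradSq u x ≤ 2 * G x y + 2 * gradSq u y := by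
      simp only [hG, gradSq, Finset.mul_sum, ← Finset.sum_add_distrib]
      refine Finset.sum_le_sum fun i _ => ?_
      nlinarith [sq_nonneg (classicalPartial i u x - 2 * classicalPartial i u y)]
    have h2 : κ * gradSq u x ≤ 2 * G x y + 2 * (κ * gradSq u y) := by
      nlinarith [mul_le_mul_of_nonneg_left h1 hκ0, mul_le_mul_of_nonneg_right hκ1 (hG0 x y)]
    rw [← ENNReal.ofReal_ofNat 2, ← ENNReal.ofReal_mul (by norm_num),
      ← ENNReal.ofReal_mul (by norm_num), ← ENNReal.ofReal_add (by have := hG0 x y; positivity)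
      (by have := gradSq_nonneg u y; positivity)]
    exact ENNReal.ofReal_le_ofReal h2
  set Q := ∫⁻ y in B, ENNReal.ofReal (κ * gradSq u y) with hQ
  have hQle : Q ≤ ENNReal.ofReal (3 / m ^ 2) *
      (ENNReal.ofReal δ * volume B + 4 * (ENNReal.ofReal (h ^ 4) * L)) :=
    lintegral_mul_gradSq_le hS hBm hBS hB hd hu hp hm h01 h23
  -- The comparison is averaged over `y ∈ B`; the factor `volume B` is cancelled afterwards.
  have key : volume B * ∫⁻ x in S, ENNReal.ofReal (κ * gradSq u x) ≤
      volume B * (M * (2 * (4 * (ENNReal.ofReal (h ^ 2) * L)) + 2 * Q)) := by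
    calc volume B * ∫⁻ x in S, ENNReal.ofReal (κ * gradSq u x)
        = ∫⁻ x in S, ∫⁻ _ in B, ENNReal.ofReal (κ * gradSq u x) := by
          simp_rw [setLIntegral_const]
          rw [lintegral_mul_const _ hgm, mul_comm]
      _ ≤ ∫⁻ x in S, (2 * (∫⁻ y in B, ENNReal.ofReal (G x y)) + 2 * Q) := by
          refine lintegral_mono fun x => (lintegral_mono fun y => hpt x y).trans_eq ?_
          rw [lintegral_add_right _ (hgm.const_mul 2), lintegral_const_mul _ hgm,
            lintegral_const_mul']
          simp
      _ = 2 * (∫⁻ x in S, ∫⁻ y in B, ENNReal.ofReal (G x y)) + 2 * Q * volume S := by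
          rw [lintegral_add_right _ measurable_const, lintegral_const_mul' _ _ (by simp),
            setLIntegral_const]
      _ ≤ 2 * (4 * (ENNReal.ofReal (h ^ 2) * L) * volume S) + 2 * Q * volume S := by
          gcongr
          exact lintegral_lintegral_gradient_sub_le hS hBm hBS hB hd hu
      _ = (2 * (4 * (ENNReal.ofReal (h ^ 2) * L)) + 2 * Q) * volume S := by ring
      _ ≤ (2 * (4 * (ENNReal.ofReal (h ^ 2) * L)) + 2 * Q) * (M * volume B) := by gcongr
      _ = _ := by ring
  refine ((ENNReal.mul_le_mul_iff_right hB0 hBt).1 key).trans ?_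
  have e1 : ENNReal.ofReal (8 * h ^ 2 + 24 * h ^ 4 / m ^ 2) =
      8 * ENNReal.ofReal (h ^ 2) + 8 * (ENNReal.ofReal (3 / m ^ 2) * ENNReal.ofReal (h ^ 4)) := by
    rw [show 8 * h ^ 2 + 24 * h ^ 4 / m ^ 2 = 8 * h ^ 2 + 8 * (3 / m ^ 2 * h ^ 4) by ring,
      ENNReal.ofReal_add (by positivity) (by positivity), ENNReal.ofReal_mul (by norm_num),
      ENNReal.ofReal_mul (by norm_num), ENNReal.ofReal_mul (by positivity), ENNReal.ofReal_ofNat]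
  have e2 : ENNReal.ofReal (6 / m ^ 2 * δ) =
      2 * (ENNReal.ofReal (3 / m ^ 2) * ENNReal.ofReal δ) := by
    rw [show 6 / m ^ 2 * δ = 2 * (3 / m ^ 2 * δ) by ring, ENNReal.ofReal_mul (by norm_num),
      ENNReal.ofReal_mul (by positivity), ENNReal.ofReal_ofNat]
  rw [e1, e2]
  gcongr M * ?_
  calc 2 * (4 * (ENNReal.ofReal (h ^ 2) * L)) + 2 * Q
      ≤ 2 * (4 * (ENNReal.ofReal (h ^ 2) * L)) + 2 * (ENNReal.ofReal (3 / m ^ 2) *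
        (ENNReal.ofReal δ * volume B + 4 * (ENNReal.ofReal (h ^ 4) * L))) := by gcongr
    _ = _ := by ring

end Plane

namespace Plane

/-! ### Mollification -/

/-- The mollification of `f` by the normed bump function `φ`. -/
noncomputable def mollify (φ : ContDiffBump (0 : Plane)) (f : Plane → ℝ) : Plane → ℝ :=
  convolution (φ.normed volume) f (ContinuousLinearMap.lsmul ℝ ℝ) volume

section Mollify

open Filter Topology

variable (φ : ContDiffBump (0 : Plane)) {f : Plane → ℝ} {K : Set Plane}

lemma contDiff_mollify (hf : LocallyIntegrable f) : ContDiff ℝ ∞ (mollify φ f) :=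
  HasCompactSupport.contDiff_convolution_left (n := ⊤) _ φ.hasCompactSupport_normed
    φ.contDiff_normed hf

lemma mollify_congr {g : Plane → ℝ} (h : f =ᵐ[volume] g) : mollify φ f = mollify φ g := by
  funext x
  refine integral_congr_ae ?_
  have := (quasiMeasurePreserving_sub_left (volume : Measure Plane) x).ae_eq_comp h
  filter_upwards [this] with t ht
  simp only [Function.comp_apply] at ht
  simp [ht]

lemma mollify_apply (x : Plane) :
    mollify φ f x = ∫ t, φ.normed volume (x - t) * f t := by
  rw [mollify, convolution_eq_swap]
  simp

lemma classicalPartial_mollify (hf : LocallyIntegrable f) (i : Fin 2) (x : Plane) :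
    classicalPartial i (mollify φ f) x =
      ∫ t, classicalPartial i (φ.normed volume) (x - t) * f t := by
  have h1 := φ.hasCompactSupport_normed (μ := volume) |>.hasFDerivAt_convolution_right
    (ContinuousLinearMap.lsmul ℝ ℝ).flip hf φ.contDiff_normed x
  rw [convolution_flip] at h1
  rw [classicalPartial, mollify, h1.fderiv,
    convolution_precompR_apply _ hf (φ.hasCompactSupport_normed.fderiv ℝ)
      ((φ.contDiff_normed (n := 1)).continuous_fderiv one_ne_zero)]
  simp only [convolution, classicalPartial]
  simp

lemma indicator_mul_integral (hK : MeasurableSet K) (u ψ : Plane → ℝ) :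
    ∫ t, ψ t * K.indicator u t = ∫ t in K, u t * ψ t := by
  rw [← integral_indicator hK]
  refine integral_congr_ae (ae_of_all _ fun t => ?_)
  by_cases ht : t ∈ K <;> simp [ht, mul_comm]

/-- The ball condition makes `t ↦ η (x - t)` a test function on `K`. It cannot be dropped in
general: the extension by zero may jump across the boundary. -/
lemma classicalPartial_mollify_indicator (hK : IsOpen K) {i : Fin 2} {u g : Plane → ℝ}
    (hu : LocallyIntegrable (K.indicator u)) (h : IsWeakPartial K i u g) {x : Plane}
    (hx : Metric.closedBall x φ.rOut ⊆ K) :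
    classicalPartial i (mollify φ (K.indicator u)) x = mollify φ (K.indicator g) x := by
  set η := φ.normed volume
  have hη : ContDiff ℝ ∞ η := φ.contDiff_normed
  have hψ : ContDiff ℝ ∞ fun t => η (x - t) := hη.comp (contDiff_const.sub contDiff_id)
  have hts : tsupport (fun t => η (x - t)) ⊆ Metric.closedBall x φ.rOut := by
    refine closure_minimal (fun t ht => ?_) Metric.isClosed_closedBall
    have : x - t ∈ Function.support η := ht
    rw [φ.support_normed_eq] at this
    rw [mem_ball_zero_iff] at this
    rw [Metric.mem_closedBall, dist_comm, dist_eq_norm]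
    exact this.le
  have hcs : HasCompactSupport fun t => η (x - t) :=
    (isCompact_closedBall x φ.rOut).of_isClosed_subset (isClosed_tsupport _) hts
  have hd : ∀ t, fderiv ℝ (fun t => η (x - t)) t (EuclideanSpace.single i 1) =
      -classicalPartial i η (x - t) := by
    intro t
    have h1 : HasFDerivAt (fun t => η (x - t))
        ((fderiv ℝ η (x - t)).comp (-ContinuousLinearMap.id ℝ Plane)) t :=
      ((hη.differentiable (by simp)) _).hasFDerivAt.comp t ((hasFDerivAt_id t).const_sub x)
    rw [h1.fderiv]
    simp [classicalPartial]
  have := h.2.2 _ hψ hcs (hts.trans hx)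
  simp only [hd, mul_neg, integral_neg, neg_inj] at this
  rw [classicalPartial_mollify φ hu, mollify_apply, indicator_mul_integral hK.measurableSet,
    indicator_mul_integral hK.measurableSet]
  exact this

/-- The first-order identity must hold near `x` to be differentiated again, hence a radius strictly
larger than `rOut`. -/
lemma classicalPartial_classicalPartial_mollify_indicator (hK : IsOpen K) {i j : Fin 2}
    {u g H : Plane → ℝ} (hu : LocallyIntegrable (K.indicator u))
    (hg : LocallyIntegrable (K.indicator g)) (h : IsWeakPartial K i u g)
    (h' : IsWeakPartial K j g H) {x : Plane} {r : ℝ} (hr : φ.rOut < r)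
    (hx : Metric.closedBall x r ⊆ K) :
    classicalPartial j (classicalPartial i (mollify φ (K.indicator u))) x =
      mollify φ (K.indicator H) x := by
  rw [← classicalPartial_mollify_indicator φ hK hg h'
    ((Metric.closedBall_subset_closedBall hr.le).trans hx)]
  have : classicalPartial i (mollify φ (K.indicator u)) =ᶠ[𝓝 x] mollify φ (K.indicator g) := by
    filter_upwards [Metric.ball_mem_nhds x (sub_pos.2 hr)] with y hy
    refine classicalPartial_mollify_indicator φ hK hu h (Subset.trans ?_ hx)
    refine Metric.closedBall_subset_closedBall' ?_
    rw [Metric.mem_ball] at hy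
    linarith
  rw [classicalPartial, this.fderiv_eq, ← classicalPartial]

/-- Mollification averages translates against a probability measure, so Jensen, Tonelli and
translation invariance suffice. -/
lemma lintegral_sq_mollify_le (hf : AEStronglyMeasurable f) :
    ∫⁻ x, ENNReal.ofReal (mollify φ f x ^ 2) ≤ ∫⁻ x, ENNReal.ofReal (f x ^ 2) := by
  obtain ⟨g, hgs, hfg⟩ := hf
  have hg := hgs.measurable
  have hfg2 : ∫⁻ x, ENNReal.ofReal (f x ^ 2) = ∫⁻ x, ENNReal.ofReal (g x ^ 2) :=
    lintegral_congr_ae (hfg.fun_comp fun y => ENNReal.ofReal (y ^ 2))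
  rw [mollify_congr φ hfg, hfg2]
  set η := φ.normed volume with hη
  have hη0 : ∀ t, 0 ≤ η t := φ.nonneg_normed
  have hηc : Continuous η := (φ.contDiff_normed (n := 0)).continuous
  set ν := (volume : Measure Plane).withDensity fun t => ENNReal.ofReal (η t) with hν
  have : IsProbabilityMeasure ν := ⟨by
    rw [hν, withDensity_apply _ MeasurableSet.univ, Measure.restrict_univ,
      ← ofReal_integral_eq_lintegral_ofReal φ.integrable_normed (ae_of_all _ hη0),
      φ.integral_normed, ENNReal.ofReal_one]⟩
  have hint : ∀ x, mollify φ g x = ∫ t, g (x - t) ∂ν := by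
    intro x
    rw [hν, integral_withDensity_eq_integral_toReal_smul (by fun_prop) (by simp)]
    refine integral_congr_ae (ae_of_all _ fun t => ?_)
    simp [hη0 t, ENNReal.toReal_ofReal, ← hη]
  calc ∫⁻ x, ENNReal.ofReal (mollify φ g x ^ 2)
      ≤ ∫⁻ x, ∫⁻ t, ENNReal.ofReal (g (x - t) ^ 2) ∂ν := by
        refine lintegral_mono fun x => ?_
        rw [hint]
        exact ofReal_sq_integral_le (by fun_prop : Measurable _).aestronglyMeasurable
    _ = ∫⁻ t, (∫⁻ x, ENNReal.ofReal (g (x - t) ^ 2)) ∂ν := by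
        rw [lintegral_lintegral_swap]
        exact (by fun_prop : Measurable _).aemeasurable
    _ = ∫⁻ _, (∫⁻ x, ENNReal.ofReal (g x ^ 2)) ∂ν :=
        lintegral_congr fun t =>
          lintegral_sub_right_eq_self (fun x => ENNReal.ofReal (g x ^ 2)) t
    _ = _ := by simp

end Mollify

/-- A sequence of bump functions whose supports shrink to the origin. -/
noncomputable def bumpSeq (n : ℕ) : ContDiffBump (0 : Plane) where
  rIn := 1 / (n + 1) / 2
  rOut := 1 / (n + 1)
  rIn_pos := by positivity
  rIn_lt_rOut := half_lt_self (by positivity)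

/-! ### Passage from mollifications to `H²` functions -/

section Limit

open Filter Topology

lemma tendsto_bumpSeq_rOut : Tendsto (fun n => (bumpSeq n).rOut) atTop (𝓝 0) :=
  tendsto_one_div_add_atTop_nhds_zero_nat

lemma ae_tendsto_mollify {f : Plane → ℝ} (hf : LocallyIntegrable f) :
    ∀ᵐ x, Tendsto (fun n => mollify (bumpSeq n) f x) atTop (𝓝 (f x)) :=
  -- The value 2 is the fixed ratio `rOut / rIn` of `bumpSeq`.
  ContDiffBump.ae_convolution_tendsto_right_of_locallyIntegrable (K := 2) tendsto_bumpSeq_rOut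
    (Eventually.of_forall fun n => by simp only [bumpSeq]; linarith) hf

lemma tendsto_mollify {f : Plane → ℝ} (hf : AEStronglyMeasurable f) {x : Plane}
    (hx : ContinuousAt f x) :
    Tendsto (fun n => mollify (bumpSeq n) f x) atTop (𝓝 (f x)) :=
  ContDiffBump.convolution_tendsto_right (g := fun _ => f) (k := fun _ => x) tendsto_bumpSeq_rOut
    (Eventually.of_forall fun _ => hf) (hx.tendsto.comp tendsto_snd) tendsto_const_nhds

variable {K : Set Plane}

lemma memLp_locallyIntegrable (hK : IsOpen K) {f : Plane → ℝ}
    (hf : MemLp f 2 (volume.restrict K)) : LocallyIntegrable (K.indicator f) :=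
  ((memLp_indicator_iff_restrict hK.measurableSet).2 hf).locallyIntegrable (by norm_num)

/-- The estimate for `H²` functions on compact star-shaped subsets of an open set. -/
lemma weak_gradient_estimate (hK : IsOpen K) {v w : Plane → ℝ} {g : Fin 2 → Plane → ℝ}
    {H : Fin 2 → Fin 2 → Plane → ℝ} (hv : MemLp v 2 (volume.restrict K))
    (hg : ∀ i, MemLp (g i) 2 (volume.restrict K))
    (hH : ∀ i j, MemLp (H i j) 2 (volume.restrict K))
    (hvg : ∀ i, IsWeakPartial K i v (g i)) (hgH : ∀ i j, IsWeakPartial K j (g i) (H i j))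
    (hw : ContinuousOn w K) (hwv : w =ᵐ[volume.restrict K] v)
    {S B : Set Plane} (hS : IsCompact S) (hSK : S ⊆ K) (hBm : MeasurableSet B)
    (hBS : B ⊆ S) (hB : ∀ y ∈ B, StarConvex ℝ y S) {h : ℝ}
    (hd : ∀ x ∈ S, ∀ y ∈ S, ‖x - y‖ ≤ h)
    {p : Fin 4 → Plane} (hp : ∀ k, p k ∈ S) {m : ℝ} (hm : 0 < m)
    (h01 : m ≤ ‖p 1 - p 0‖) (h23 : m ≤ ‖p 3 - p 2‖) (hB0 : volume B ≠ 0)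
    {M : ENNReal} (hM : M ≠ ⊤) (hvol : volume S ≤ M * volume B) :
    ∫⁻ x in S, ENNReal.ofReal ((1 - absCos (p 1 - p 0) (p 3 - p 2)) * ∑ i, g i x ^ 2) ≤
      M * (ENNReal.ofReal (8 * h ^ 2 + 24 * h ^ 4 / m ^ 2) *
          (∫⁻ z in K, ENNReal.ofReal (∑ i, ∑ j, H i j z ^ 2)) +
        ENNReal.ofReal (6 / m ^ 2 * ((w (p 1) - w (p 0)) ^ 2 + (w (p 3) - w (p 2)) ^ 2)) *
          volume B) := by
  have hKm := hK.measurableSet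
  have hBt : volume B ≠ ⊤ := ((measure_mono hBS).trans_lt hS.measure_lt_top).ne
  obtain ⟨r, hr, hrK⟩ := hS.exists_cthickening_subset_open hK hSK
  have hball : ∀ x ∈ S, Metric.closedBall x r ⊆ K := fun x hx =>
    (Metric.closedBall_subset_cthickening hx r).trans hrK
  have hvl := memLp_locallyIntegrable hK hv
  have hgl := fun i => memLp_locallyIntegrable hK (hg i)
  set U : ℕ → Plane → ℝ := fun n => mollify (bumpSeq n) (K.indicator v) with hU
  have hUs : ∀ n, ContDiff ℝ ∞ (U n) := fun n => contDiff_mollify _ hvl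
  set κ := 1 - absCos (p 1 - p 0) (p 3 - p 2) with hκ
  have hsmall : ∀ᶠ n in atTop, (bumpSeq n).rOut < r :=
    tendsto_bumpSeq_rOut.eventually (gt_mem_nhds hr)
  -- Mollifications depend only on the a.e. class, so their point values converge to those of the
  -- continuous `w`.
  have hwind : K.indicator v =ᵐ[volume] K.indicator w := by
    filter_upwards [(ae_restrict_iff' hKm).1 hwv] with x hx
    by_cases hxK : x ∈ K
    · simp [hxK, hx hxK]
    · simp [hxK]
  have hUp : ∀ k, Tendsto (fun n => U n (p k)) atTop (𝓝 (w (p k))) := by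
    intro k
    have hk : p k ∈ K := hSK (hp k)
    have hev : K.indicator w =ᶠ[𝓝 (p k)] w := by
      filter_upwards [hK.mem_nhds hk] with x hx using indicator_of_mem hx w
    have h1 := tendsto_mollify (f := K.indicator w)
      (hvl.aestronglyMeasurable.congr hwind)
      ((hw.continuousAt (hK.mem_nhds hk)).congr hev.symm)
    rw [indicator_of_mem hk] at h1
    refine h1.congr fun n => ?_
    simp only [hU, mollify_congr _ hwind]
  have hgrad : ∀ᵐ x ∂(volume.restrict S),
      Tendsto (fun n => ENNReal.ofReal (κ * gradSq (U n) x)) atTop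
        (𝓝 (ENNReal.ofReal (κ * ∑ i, g i x ^ 2))) := by
    have h1 : ∀ᵐ x : Plane, ∀ i, Tendsto (fun n => mollify (bumpSeq n) (K.indicator (g i)) x) atTop
        (𝓝 (K.indicator (g i) x)) := ae_all_iff.2 fun i => ae_tendsto_mollify (hgl i)
    filter_upwards [ae_restrict_of_ae h1, ae_restrict_mem hS.measurableSet] with x hx hxS
    refine ENNReal.tendsto_ofReal (Tendsto.const_mul _ (tendsto_finsetSum _ fun i _ =>
      Tendsto.pow ?_ 2))
    have h2 := hx i
    rw [indicator_of_mem (hSK hxS)] at h2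
    refine h2.congr' ?_
    filter_upwards [hsmall] with n hn
    exact (classicalPartial_mollify_indicator _ hK hvl (hvg i)
      ((Metric.closedBall_subset_closedBall hn.le).trans (hball x hxS))).symm
  have hhess : ∀ n, (bumpSeq n).rOut < r → ∫⁻ z in S, ENNReal.ofReal (hessSq (U n) z) ≤
      ∫⁻ z in K, ENNReal.ofReal (∑ i, ∑ j, H i j z ^ 2) := by
    intro n hn
    have hHm : ∀ i j, AEMeasurable (fun z => ENNReal.ofReal (H i j z ^ 2)) (volume.restrict K) :=
      fun i j => ((hH i j).1.aemeasurable.pow_const 2).ennreal_ofReal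
    have hind : ∀ i j, AEStronglyMeasurable (K.indicator (H i j)) volume := fun i j =>
      (memLp_locallyIntegrable hK (hH i j)).aestronglyMeasurable
    have hmm : ∀ i j, Measurable fun z =>
        ENNReal.ofReal (mollify (bumpSeq n) (K.indicator (H i j)) z ^ 2) := fun i j =>
      ((contDiff_mollify _ (memLp_locallyIntegrable hK (hH i j))).continuous.pow 2).measurable
        |>.ennreal_ofReal
    calc ∫⁻ z in S, ENNReal.ofReal (hessSq (U n) z)
        = ∫⁻ z in S, ∑ i, ∑ j,
            ENNReal.ofReal (mollify (bumpSeq n) (K.indicator (H i j)) z ^ 2) := by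
          refine setLIntegral_congr_fun hS.measurableSet fun z hz => ?_
          simp only [hessSq, gradSq]
          rw [ENNReal.ofReal_sum_of_nonneg fun _ _ => Finset.sum_nonneg fun _ _ => sq_nonneg _]
          refine Finset.sum_congr rfl fun i _ => ?_
          rw [ENNReal.ofReal_sum_of_nonneg fun _ _ => sq_nonneg _]
          refine Finset.sum_congr rfl fun j _ => ?_
          rw [hU, classicalPartial_classicalPartial_mollify_indicator _ hK hvl (hgl i) (hvg i)
            (hgH i j) hn (hball z hz)]
      _ ≤ ∫⁻ z, ∑ i, ∑ j,
            ENNReal.ofReal (mollify (bumpSeq n) (K.indicator (H i j)) z ^ 2) :=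
          setLIntegral_le_lintegral _ _
      _ = ∑ i, ∑ j, ∫⁻ z,
            ENNReal.ofReal (mollify (bumpSeq n) (K.indicator (H i j)) z ^ 2) := by
          rw [lintegral_finsetSum _ fun i _ => Finset.measurable_fun_sum _ fun j _ => hmm i j]
          exact Finset.sum_congr rfl fun i _ => lintegral_finsetSum _ fun j _ => hmm i j
      _ ≤ ∑ i, ∑ j, ∫⁻ z in K, ENNReal.ofReal (H i j z ^ 2) := by
          refine Finset.sum_le_sum fun i _ => Finset.sum_le_sum fun j _ =>
            (lintegral_sq_mollify_le _ (hind i j)).trans_eq ?_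
          rw [← lintegral_indicator hKm]
          refine lintegral_congr fun z => ?_
          by_cases hz : z ∈ K <;> simp [hz]
      _ = _ := by
          simp_rw [ENNReal.ofReal_sum_of_nonneg fun i _ => Finset.sum_nonneg fun j _ =>
            sq_nonneg (H i j _), ENNReal.ofReal_sum_of_nonneg fun _ _ => sq_nonneg _]
          rw [lintegral_finsetSum' _ fun i _ => Finset.aemeasurable_fun_sum _ fun j _ => hHm i j]
          exact Finset.sum_congr rfl fun i _ =>
            (lintegral_finsetSum' _ fun j _ => hHm i j).symm
  set L := ∫⁻ z in K, ENNReal.ofReal (∑ i, ∑ j, H i j z ^ 2) with hL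
  have hlim : Tendsto (fun n => M * (ENNReal.ofReal (8 * h ^ 2 + 24 * h ^ 4 / m ^ 2) * L +
      ENNReal.ofReal (6 / m ^ 2 * ((U n (p 1) - U n (p 0)) ^ 2 + (U n (p 3) - U n (p 2)) ^ 2)) *
        volume B)) atTop
      (𝓝 (M * (ENNReal.ofReal (8 * h ^ 2 + 24 * h ^ 4 / m ^ 2) * L +
        ENNReal.ofReal (6 / m ^ 2 * ((w (p 1) - w (p 0)) ^ 2 + (w (p 3) - w (p 2)) ^ 2)) *
          volume B))) := by
    refine ENNReal.Tendsto.const_mul (tendsto_const_nhds.add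
      (ENNReal.Tendsto.mul_const (ENNReal.tendsto_ofReal ?_) (Or.inr hBt))) (Or.inr hM)
    exact ((((hUp 1).sub (hUp 0)).pow 2).add (((hUp 3).sub (hUp 2)).pow 2)).const_mul _
  -- Fatou's lemma needs only a.e. convergence of the gradients; the right side converges, with the
  -- Hessians bounded by the fixed `L`.
  calc ∫⁻ x in S, ENNReal.ofReal (κ * ∑ i, g i x ^ 2)
      = ∫⁻ x in S, liminf (fun n => ENNReal.ofReal (κ * gradSq (U n) x)) atTop :=
        lintegral_congr_ae (hgrad.mono fun x hx => hx.liminf_eq.symm)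
    _ ≤ liminf (fun n => ∫⁻ x in S, ENNReal.ofReal (κ * gradSq (U n) x)) atTop :=
        lintegral_liminf_le fun n =>
          ((continuous_gradSq (hUs n)).measurable.const_mul κ).ennreal_ofReal
    _ ≤ liminf (fun n => M * (ENNReal.ofReal (8 * h ^ 2 + 24 * h ^ 4 / m ^ 2) * L +
          ENNReal.ofReal (6 / m ^ 2 * ((U n (p 1) - U n (p 0)) ^ 2 +
            (U n (p 3) - U n (p 2)) ^ 2)) * volume B)) atTop := by
        refine liminf_le_liminf ?_
        filter_upwards [hsmall] with n hn
        refine (gradient_estimate hS.measurableSet hBm hBS hB hd (hUs n) hp hm h01 h23 hB0 hBt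
          hvol).trans ?_
        gcongr
        exact hhess n hn
    _ = _ := hlim.liminf_eq

end Limit

end Plane

namespace Plane

/-! ### Weak derivatives of `H²` functions -/

section Weak

variable {K : Set Plane} {i : Fin 2} {u g g' : Plane → ℝ}

lemma IsWeakPartial.ae_eq (hK : IsOpen K) (h : IsWeakPartial K i u g)
    (h' : IsWeakPartial K i u g') : g =ᵐ[volume.restrict K] g' := by
  have key := hK.ae_eq_zero_of_integral_contDiff_smul_eq_zero (h.2.1.sub h'.2.1)
    (fun φ hφ hc hs => ?_)
  · refine (ae_restrict_iff' hK.measurableSet).2 (key.mono fun x hx hxK => ?_)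
    exact sub_eq_zero.1 (hx hxK)
  · have hint : ∀ f : Plane → ℝ, LocallyIntegrableOn f K →
        IntegrableOn (fun x => f x * φ x) K := by
      intro f hf
      have h1 : IntegrableOn f (tsupport φ) := hf.integrableOn_compact_subset hs hc
      have h2 : IntegrableOn (fun x => f x * φ x) (tsupport φ) :=
        h1.mul_continuousOn hφ.continuous.continuousOn hc
      have h3 : Integrable fun x => f x * φ x := by
        refine (integrableOn_iff_integrable_of_support_subset fun x hx => ?_).1 h2
        exact subset_tsupport φ (right_ne_zero_of_mul hx)
      exact h3.integrableOn
    have e : ∫ x in K, g x * φ x = ∫ x in K, g' x * φ x :=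
      neg_injective ((h.2.2 φ hφ hc hs).symm.trans (h'.2.2 φ hφ hc hs))
    have hsupp : Function.support (fun x => φ x • (g - g') x) ⊆ K := fun x hx =>
      hs (subset_tsupport φ (left_ne_zero_of_mul hx))
    rw [← setIntegral_eq_integral_of_forall_compl_eq_zero (s := K)
      (fun x hx => Function.notMem_support.1 fun h => hx (hsupp h))]
    calc ∫ x in K, φ x • (g - g') x = ∫ x in K, (g x * φ x - g' x * φ x) := by
          refine integral_congr_ae (ae_of_all _ fun x => ?_)
          simp only [Pi.sub_apply, smul_eq_mul]
          ring
      _ = 0 := by rw [integral_sub (hint g h.2.1) (hint g' h'.2.1), e, sub_self]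

lemma isWeakPartial_weakPartial (h : IsWeakPartial K i u g) :
    IsWeakPartial K i u (weakPartial K i u) := by
  have hex : ∃ g, IsWeakPartial K i u g := ⟨g, h⟩
  rw [weakPartial, dif_pos hex]
  exact hex.choose_spec

lemma IsWeakPartial.congr_left {u' : Plane → ℝ} (h : IsWeakPartial K i u g)
    (hu' : LocallyIntegrableOn u' K) (hu : u =ᵐ[volume.restrict K] u') :
    IsWeakPartial K i u' g := by
  refine ⟨hu', h.2.1, fun φ hφ hc hs => ?_⟩
  rw [← h.2.2 φ hφ hc hs]
  exact integral_congr_ae (hu.mono fun x hx => by simp only [hx])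

/-- `MemH` provides some weak derivatives, `weakPartial` chosen ones. Uniqueness a.e. transfers
square integrability and, at second order, the right to differentiate again. -/
lemma MemH.weakPartial_spec {v : Plane → ℝ} (hK : IsOpen K) (hv : MemH K 2 v) :
    (∀ i, IsWeakPartial K i v (weakPartial K i v) ∧
      MemLp (weakPartial K i v) 2 (volume.restrict K)) ∧
    ∀ i j, IsWeakPartial K j (weakPartial K i v) (weakPartial K j (weakPartial K i v)) ∧
      MemLp (weakPartial K j (weakPartial K i v)) 2 (volume.restrict K) := by
  refine ⟨fun i => ?_, fun i j => ?_⟩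
  · obtain ⟨g, hg, hgm⟩ := hv.2 i
    have hw := isWeakPartial_weakPartial hg
    exact ⟨hw, (memLp_congr_ae (hg.ae_eq hK hw)).1 hgm.1⟩
  · obtain ⟨g, hg, hgm⟩ := hv.2 i
    have hw := isWeakPartial_weakPartial hg
    obtain ⟨H, hH, hHm⟩ := hgm.2 j
    have hH' := hH.congr_left hw.2.1 (hg.ae_eq hK hw)
    have hw' := isWeakPartial_weakPartial hH'
    exact ⟨hw', (memLp_congr_ae (hH'.ae_eq hK hw')).1 hHm⟩

end Weak

/-! ### Star-shaped domains -/

section Star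

open Filter Topology

variable {K : Set Plane} {x₀ : Plane} {r : ℝ}

/-- Take `x' ∈ K` close to `x` and compensate by moving `y` to `y' = y + (t/(1-t))(x - x')`, still
in the ball: the segment from `y'` to `x'` passes through the same point. -/
lemma closure_segment_mem (hstar : ∀ y ∈ Metric.ball x₀ r, StarConvex ℝ y K) {x y : Plane} (hx : x ∈ closure K)
    (hy : y ∈ Metric.ball x₀ r) {t : ℝ} (ht : 0 ≤ t) (ht1 : t < 1) : y + t • (x - y) ∈ K := by
  have hs : 0 < 1 - t := sub_pos.2 ht1
  have hcont : Continuous fun x' : Plane => y + (t / (1 - t)) • (x - x') := by fun_prop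
  have hnear : ∀ᶠ x' in 𝓝 x, y + (t / (1 - t)) • (x - x') ∈ Metric.ball x₀ r := by
    refine hcont.continuousAt.eventually_mem (Metric.isOpen_ball.mem_nhds ?_)
    simpa using hy
  obtain ⟨x', hx', hx'K⟩ := (mem_closure_iff_frequently.1 hx).and_eventually hnear |>.exists
  have h1 := (hstar _ hx'K).add_smul_sub_mem hx' ht ht1.le
  convert h1 using 1
  have e : t = (1 - t) * (t / (1 - t)) := by field_simp
  have e2 : t • (x - x') = (1 - t) • ((t / (1 - t)) • (x - x')) := by rw [smul_smul, ← e]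
  set z := (t / (1 - t)) • (x - x')
  calc y + t • (x - y) = (y + t • (x' - y)) + t • (x - x') := by module
    _ = (y + t • (x' - y)) + (1 - t) • z := by rw [e2]
    _ = _ := by module

lemma starConvex_closure (hball : Metric.ball x₀ r ⊆ K)
    (hstar : ∀ y ∈ Metric.ball x₀ r, StarConvex ℝ y K) {y : Plane}
    (hy : y ∈ Metric.ball x₀ r) : StarConvex ℝ y (closure K) := by
  rw [starConvex_iff_forall_pos (subset_closure (hball hy))]
  intro x hx a b _ hb hab
  obtain rfl : a = 1 - b := eq_sub_of_add_eq hab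
  have := closure_segment_mem hstar hx hy hb.le (by linarith)
  convert subset_closure this using 1
  module

/-- The homothetic copy of the closure of `K` with ratio `t`. -/
def shrink (K : Set Plane) (x₀ : Plane) (t : ℝ) : Set Plane :=
  AffineMap.homothety x₀ t '' closure K

lemma homothety_eq (t : ℝ) (x : Plane) : AffineMap.homothety x₀ t x = x₀ + t • (x - x₀) := by
  simp [AffineMap.homothety_apply, add_comm]

lemma isCompact_shrink (hb : Bornology.IsBounded K) (t : ℝ) : IsCompact (shrink K x₀ t) :=
  hb.isCompact_closure.image (AffineMap.homothety_continuous x₀ t)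

lemma shrink_subset (hr : 0 < r)
    (hstar : ∀ y ∈ Metric.ball x₀ r, StarConvex ℝ y K) {t : ℝ} (ht : 0 ≤ t) (ht1 : t < 1) :
    shrink K x₀ t ⊆ K := by
  rintro _ ⟨x, hx, rfl⟩
  rw [homothety_eq]
  exact closure_segment_mem hstar hx (Metric.mem_ball_self hr) ht ht1

lemma exists_homothety_eq_of_mem_ball {t : ℝ} (ht : 0 < t) {y : Plane}
    (hy : y ∈ Metric.ball x₀ (t * r)) :
    ∃ z ∈ Metric.ball x₀ r, AffineMap.homothety x₀ t z = y := by
  refine ⟨x₀ + t⁻¹ • (y - x₀), ?_, ?_⟩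
  · rw [mem_ball_iff_norm] at hy ⊢
    rw [add_sub_cancel_left, norm_smul, norm_inv, Real.norm_of_nonneg ht.le,
      inv_mul_lt_iff₀ ht]
    exact hy
  · rw [homothety_eq, add_sub_cancel_left, smul_smul, mul_inv_cancel₀ ht.ne']
    simp

lemma ball_subset_shrink (hball : Metric.ball x₀ r ⊆ K) {t : ℝ} (ht : 0 < t) :
    Metric.ball x₀ (t * r) ⊆ shrink K x₀ t := fun y hy => by
  obtain ⟨z, hz, rfl⟩ := exists_homothety_eq_of_mem_ball ht hy
  exact ⟨z, subset_closure (hball hz), rfl⟩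

lemma starConvex_shrink (hball : Metric.ball x₀ r ⊆ K)
    (hstar : ∀ y ∈ Metric.ball x₀ r, StarConvex ℝ y K) {t : ℝ} (ht : 0 < t) {y : Plane}
    (hy : y ∈ Metric.ball x₀ (t * r)) : StarConvex ℝ y (shrink K x₀ t) := by
  obtain ⟨z, hz, rfl⟩ := exists_homothety_eq_of_mem_ball ht hy
  exact (starConvex_closure hball hstar hz).affine_image _

/-- The set lies in a disc of radius `t h`, and `h ≤ r / ρ`; areas scale quadratically. -/
lemma volume_shrink_le {h ρ : ℝ} (hρ : 0 < ρ) (hr : 0 < r) (hrh : ρ * h ≤ r) (hh : 0 ≤ h)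
    (hK : ∀ x ∈ closure K, dist x x₀ ≤ h) {t : ℝ} (ht : 0 ≤ t) :
    volume (shrink K x₀ t) ≤ ENNReal.ofReal (1 / ρ ^ 2) * volume (Metric.ball x₀ (t * r)) := by
  have hsub : shrink K x₀ t ⊆ Metric.closedBall x₀ (t * h) := by
    rintro _ ⟨x, hx, rfl⟩
    rw [homothety_eq, mem_closedBall_iff_norm, add_sub_cancel_left, norm_smul,
      Real.norm_of_nonneg ht, ← dist_eq_norm]
    exact mul_le_mul_of_nonneg_left (hK x hx) ht
  refine (measure_mono hsub).trans ?_
  rw [Measure.addHaar_closedBall _ _ (by positivity), Measure.addHaar_ball _ x₀ (by positivity : 0 ≤ t * r),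
    ← mul_assoc, ← ENNReal.ofReal_mul (by positivity)]
  gcongr ?_ * _
  refine ENNReal.ofReal_le_ofReal ?_
  simp only [finrank_euclideanSpace, Fintype.card_fin]
  rw [one_div, inv_mul_eq_div, le_div_iff₀ (by positivity)]
  calc (t * h) ^ 2 * ρ ^ 2 = (t * (ρ * h)) ^ 2 := by ring
    _ ≤ (t * r) ^ 2 := by gcongr

/-- Ratios increasing to one. -/
noncomputable def ratio (n : ℕ) : ℝ := 1 - 1 / ((n + 1 : ℕ) + 1)

lemma ratio_lt_one (n : ℕ) : ratio n < 1 := sub_lt_self _ (by positivity)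

/-- The index shift in `ratio` makes the first ratio `1/2` instead of 0. -/
lemma half_le_ratio (n : ℕ) : 1 / 2 ≤ ratio n := by
  have : (1 : ℝ) / ((n + 1 : ℕ) + 1) ≤ 1 / 2 :=
    one_div_le_one_div_of_le (by norm_num) (by push_cast; linarith [n.cast_nonneg (α := ℝ)])
  rw [ratio]
  linarith

lemma ratio_pos (n : ℕ) : 0 < ratio n := by linarith [half_le_ratio n]

lemma tendsto_ratio : Tendsto ratio atTop (𝓝 1) := by
  have := (tendsto_one_div_add_atTop_nhds_zero_nat (𝕜 := ℝ)).comp (tendsto_add_atTop_nat 1)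
  have h1 := this.const_sub 1
  rwa [sub_zero] at h1

lemma eventually_mem_shrink (hK : IsOpen K) {x : Plane} (hx : x ∈ K) :
    ∀ᶠ n in atTop, x ∈ shrink K x₀ (ratio n) := by
  have h1 : Tendsto (fun n => x₀ + (ratio n)⁻¹ • (x - x₀)) atTop (𝓝 x) := by
    have := ((tendsto_ratio.inv₀ one_ne_zero).smul_const (x - x₀)).const_add x₀
    simpa using this
  filter_upwards [h1.eventually_mem (hK.mem_nhds hx)] with n hn
  refine ⟨_, subset_closure hn, ?_⟩
  rw [homothety_eq, add_sub_cancel_left, smul_smul, mul_inv_cancel₀ (ratio_pos n).ne']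
  simp

lemma tendsto_comp_homothety (hr : 0 < r)
    (hstar : ∀ y ∈ Metric.ball x₀ r, StarConvex ℝ y K) {w : Plane → ℝ}
    (hw : ContinuousOn w (closure K)) {x : Plane} (hx : x ∈ closure K) :
    Tendsto (fun n => w (AffineMap.homothety x₀ (ratio n) x)) atTop (𝓝 (w x)) := by
  refine (hw x hx).tendsto.comp (tendsto_nhdsWithin_iff.2 ⟨?_, Eventually.of_forall fun n =>
    subset_closure (shrink_subset hr hstar (ratio_pos n).le (ratio_lt_one n)
      ⟨x, hx, rfl⟩)⟩)
  simp only [homothety_eq]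
  have := (tendsto_ratio.smul_const (x - x₀)).const_add x₀
  simpa using this

lemma ofReal_sum_integral_sq {ι : Type*} [Fintype ι] {f : ι → Plane → ℝ}
    (hf : ∀ i, MemLp (f i) 2 (volume.restrict K)) :
    ENNReal.ofReal (∑ i, ∫ x in K, f i x ^ 2) = ∫⁻ x in K, ENNReal.ofReal (∑ i, f i x ^ 2) := by
  rw [← integral_finsetSum _ fun i _ => (hf i).integrable_sq,
    ofReal_integral_eq_lintegral_ofReal (integrable_finsetSum _ fun i _ => (hf i).integrable_sq)
      (ae_of_all _ fun x => Finset.sum_nonneg fun _ _ => sq_nonneg _)]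

/-- The Poincaré inequality for `H²` functions taking equal values at the ends of two segments. -/
theorem mul_seminormH1_sq_le {ρ : ℝ} (hρ : 0 < ρ) (hK : IsOpen K) (hb : Bornology.IsBounded K)
    (hdiam : 0 < Metric.diam K) (hrh : ρ * Metric.diam K ≤ r) (hball : Metric.ball x₀ r ⊆ K)
    (hstar : ∀ y ∈ Metric.ball x₀ r, StarConvex ℝ y K) {v w : Plane → ℝ} (hv : MemH K 2 v)
    (hw : IsContinuousRep K v w) {p : Fin 4 → Plane} (hp : ∀ k, p k ∈ closure K)
    (h01 : ρ * Metric.diam K ≤ ‖p 1 - p 0‖) (h23 : ρ * Metric.diam K ≤ ‖p 3 - p 2‖)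
    (hw01 : w (p 0) = w (p 1)) (hw23 : w (p 2) = w (p 3)) :
    (1 - absCos (p 1 - p 0) (p 3 - p 2)) * seminormH1 K v ^ 2 ≤
      1 / ρ ^ 2 * (8 + 96 / ρ ^ 2) * (Metric.diam K * seminormH2 K v) ^ 2 := by
  obtain ⟨hG, hH⟩ := MemH.weakPartial_spec hK hv
  set h := Metric.diam K with hh
  set G : Fin 2 → Plane → ℝ := fun i => weakPartial K i v with hGdef
  set H : Fin 2 → Fin 2 → Plane → ℝ := fun i j => weakPartial K j (weakPartial K i v) with hHdef
  set κ := 1 - absCos (p 1 - p 0) (p 3 - p 2) with hκ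
  have hκ0 : 0 ≤ κ := sub_nonneg.2 (absCos_le_one _ _)
  have hr : 0 < r := (mul_pos hρ hdiam).trans_le hrh
  have hdist : ∀ x ∈ closure K, ∀ y ∈ closure K, dist x y ≤ h := fun x hx y hy => by
    rw [hh, ← Metric.diam_closure]
    exact Metric.dist_le_diam_of_mem hb.closure hx hy
  have hx₀ : x₀ ∈ closure K := subset_closure (hball (Metric.mem_ball_self hr))
  -- Edges have length at least `ρ h`, and shrinking by a ratio at least `1/2` costs the factor 2.
  set m := ρ * h / 2 with hm
  have hm0 : 0 < m := by positivity
  set L := ∫⁻ z in K, ENNReal.ofReal (∑ i, ∑ j, H i j z ^ 2) with hL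
  set q : ℕ → Fin 4 → Plane := fun n k => AffineMap.homothety x₀ (ratio n) (p k) with hq
  set M := ENNReal.ofReal (1 / ρ ^ 2) with hM
  have hqsub : ∀ n k l, q n k - q n l = ratio n • (p k - p l) := fun n k l => by
    simp only [hq, homothety_eq]; module
  have hqm : ∀ n k l, ρ * h ≤ ‖p k - p l‖ → m ≤ ‖q n k - q n l‖ := fun n k l hkl => by
    rw [hqsub, norm_smul, Real.norm_of_nonneg (ratio_pos n).le, hm]
    nlinarith [half_le_ratio n, mul_pos hρ hdiam]
  -- Homotheties preserve directions, so `κ` does not depend on `n`.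
  have hqcos : ∀ n, absCos (q n 1 - q n 0) (q n 3 - q n 2) =
      absCos (p 1 - p 0) (p 3 - p 2) := fun n => by
    rw [hqsub, hqsub, absCos, InnerProductGeometry.angle_smul_left_of_pos _ _ (ratio_pos n),
      InnerProductGeometry.angle_smul_right_of_pos _ _ (ratio_pos n), absCos]
  have hest : ∀ n, ∫⁻ x in shrink K x₀ (ratio n), ENNReal.ofReal (κ * ∑ i, G i x ^ 2) ≤
      M * (ENNReal.ofReal (8 * h ^ 2 + 24 * h ^ 4 / m ^ 2) * L +
        ENNReal.ofReal (6 / m ^ 2 * ((w (q n 1) - w (q n 0)) ^ 2 + (w (q n 3) - w (q n 2)) ^ 2)) *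
          volume (Metric.ball x₀ r)) := by
    intro n
    have hSK := shrink_subset hr hstar (ratio_pos n).le (ratio_lt_one n)
    have := weak_gradient_estimate hK hv.1 (fun i => (hG i).2) (fun i j => (hH i j).2)
      (fun i => (hG i).1) (fun i j => (hH i j).1) (hw.1.mono subset_closure) hw.2
      (isCompact_shrink hb (ratio n)) hSK measurableSet_ball
      (ball_subset_shrink hball (ratio_pos n))
      (fun y hy => starConvex_shrink hball hstar (ratio_pos n) hy)
      (fun x hx y hy => dist_eq_norm x y ▸
        hdist x (subset_closure (hSK hx)) y (subset_closure (hSK hy)))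
      (p := q n) (fun k => ⟨p k, hp k, rfl⟩) hm0 (hqm n 1 0 h01) (hqm n 3 2 h23)
      (Metric.measure_ball_pos _ _ (mul_pos (ratio_pos n) hr)).ne' ENNReal.ofReal_ne_top
      (volume_shrink_le hρ hr hrh hdiam.le (fun x hx => hdist x hx x₀ hx₀) (ratio_pos n).le)
    rw [hqcos] at this
    refine this.trans ?_
    gcongr
    exact mul_le_of_le_one_left hr.le (ratio_lt_one n).le
  have hlim : Tendsto (fun n => M * (ENNReal.ofReal (8 * h ^ 2 + 24 * h ^ 4 / m ^ 2) * L +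
        ENNReal.ofReal (6 / m ^ 2 * ((w (q n 1) - w (q n 0)) ^ 2 + (w (q n 3) - w (q n 2)) ^ 2)) *
          volume (Metric.ball x₀ r))) atTop
      (𝓝 (M * (ENNReal.ofReal (8 * h ^ 2 + 24 * h ^ 4 / m ^ 2) * L +
        ENNReal.ofReal (6 / m ^ 2 * ((w (p 1) - w (p 0)) ^ 2 + (w (p 3) - w (p 2)) ^ 2)) *
          volume (Metric.ball x₀ r)))) := by
    have hqt := fun k => tendsto_comp_homothety hr hstar hw.1 (hp k)
    refine ENNReal.Tendsto.const_mul (tendsto_const_nhds.add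
      (ENNReal.Tendsto.mul_const (ENNReal.tendsto_ofReal ?_) (Or.inr measure_ball_lt_top.ne)))
      (Or.inr ENNReal.ofReal_ne_top)
    exact ((((hqt 1).sub (hqt 0)).pow 2).add (((hqt 3).sub (hqt 2)).pow 2)).const_mul _
  have hGm : AEMeasurable (fun x => ENNReal.ofReal (κ * ∑ i, G i x ^ 2)) (volume.restrict K) :=
    ((Finset.aemeasurable_fun_sum _ fun i _ =>
      (hG i).2.1.aemeasurable.pow_const 2).const_mul κ).ennreal_ofReal
  have hmain : ∫⁻ x in K, ENNReal.ofReal (κ * ∑ i, G i x ^ 2) ≤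
      M * (ENNReal.ofReal (8 * h ^ 2 + 24 * h ^ 4 / m ^ 2) * L) := by
    set F : Plane → ENNReal := fun x => ENNReal.ofReal (κ * ∑ i, G i x ^ 2) with hF
    have hmeas : ∀ n, MeasurableSet (shrink K x₀ (ratio n)) := fun n =>
      (isCompact_shrink hb _).measurableSet
    calc ∫⁻ x in K, F x
        ≤ ∫⁻ x in K, liminf (fun n => (shrink K x₀ (ratio n)).indicator F x) atTop := by
          refine setLIntegral_mono' hK.measurableSet fun x hx => ?_
          refine (tendsto_const_nhds.congr' ?_ : Tendsto _ _ (𝓝 (F x))).liminf_eq.ge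
          filter_upwards [eventually_mem_shrink (x₀ := x₀) hK hx] with n hn
          rw [indicator_of_mem hn]
      _ ≤ liminf (fun n => ∫⁻ x in K, (shrink K x₀ (ratio n)).indicator F x) atTop :=
          lintegral_liminf_le' fun n => hGm.indicator (hmeas n)
      _ ≤ liminf (fun n => M * (ENNReal.ofReal (8 * h ^ 2 + 24 * h ^ 4 / m ^ 2) * L +
            ENNReal.ofReal (6 / m ^ 2 * ((w (q n 1) - w (q n 0)) ^ 2 +
              (w (q n 3) - w (q n 2)) ^ 2)) * volume (Metric.ball x₀ r))) atTop := by
          refine liminf_le_liminf (Eventually.of_forall fun n => ?_)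
          refine (setLIntegral_le_lintegral _ _).trans ?_
          rw [lintegral_indicator (hmeas n)]
          exact hest n
      _ = _ := by
          rw [hlim.liminf_eq, hw01, hw23]
          simp
  have hconst : 8 * h ^ 2 + 24 * h ^ 4 / m ^ 2 = (8 + 96 / ρ ^ 2) * h ^ 2 := by
    rw [hm]; field_simp; ring
  have hs1 : ENNReal.ofReal (κ * seminormH1 K v ^ 2) =
      ∫⁻ x in K, ENNReal.ofReal (κ * ∑ i, G i x ^ 2) := by
    rw [seminormH1, Real.sq_sqrt (Finset.sum_nonneg fun i _ => integral_nonneg fun x => sq_nonneg _),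
      ENNReal.ofReal_mul hκ0, ofReal_sum_integral_sq fun i => (hG i).2,
      ← lintegral_const_mul' _ _ ENNReal.ofReal_ne_top]
    simp only [ENNReal.ofReal_mul hκ0, hGdef]
  have hs2 : ENNReal.ofReal (seminormH2 K v ^ 2) = L := by
    rw [seminormH2, Real.sq_sqrt (Finset.sum_nonneg fun i _ => Finset.sum_nonneg fun j _ =>
      integral_nonneg fun x => sq_nonneg _)]
    have := ofReal_sum_integral_sq (K := K) (f := fun ij : Fin 2 × Fin 2 => H ij.1 ij.2)
      fun ij => (hH ij.1 ij.2).2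
    simpa only [Fintype.sum_prod_type] using this
  rw [← hs1, ← hs2, hconst, hM, ← ENNReal.ofReal_mul (by positivity),
    ← ENNReal.ofReal_mul (by positivity)] at hmain
  refine ((ENNReal.ofReal_le_ofReal_iff (by positivity)).1 hmain).trans_eq ?_
  ring

end Star

end Plane

namespace Plane

/-! ### Geometry of star-shaped polygons -/

/-- The cross product of two vectors of the plane. -/
def cross (d e : Plane) : ℝ := d 0 * e 1 - d 1 * e 0

lemma cross_sq_add_inner_sq (d e : Plane) :
    cross d e ^ 2 + inner ℝ d e ^ 2 = ‖d‖ ^ 2 * ‖e‖ ^ 2 := by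
  rw [norm_sq_eq, norm_sq_eq, inner_eq, cross]
  ring

lemma cross_smul_left (c : ℝ) (d e : Plane) : cross (c • d) e = c * cross d e := by
  simp [cross]; ring

lemma cross_smul_right (c : ℝ) (d e : Plane) : cross d (c • e) = c * cross d e := by
  simp [cross]; ring

lemma cross_self (d : Plane) : cross d d = 0 := by
  simp [cross]; ring

lemma exists_eq_smul_of_cross_eq_zero {d e : Plane} (he : e ≠ 0) (h : cross d e = 0) :
    ∃ c : ℝ, d = c • e := by
  refine ⟨inner ℝ d e / ‖e‖ ^ 2, ?_⟩
  have he' : e 0 ^ 2 + e 1 ^ 2 ≠ 0 := by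
    rw [← norm_sq_eq]; simpa using he
  rw [norm_sq_eq, inner_eq]
  rw [cross] at h
  ext i
  fin_cases i
  · simp
    field_simp
    linear_combination (e 1) * h
  · simp
    field_simp
    linear_combination -(e 0) * h

/-- The hypothesis says `sin² ≥ ρ²`, and `1 - |cos| = sin² / (1 + |cos|) ≥ sin² / 2`. -/
lemma absCos_le_of_cross {ρ : ℝ} {d e : Plane} (hd : d ≠ 0) (he : e ≠ 0)
    (h : ρ ^ 2 * (‖d‖ ^ 2 * ‖e‖ ^ 2) ≤ cross d e ^ 2) : ρ ^ 2 / 2 ≤ 1 - absCos d e := by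
  have hpos : 0 < ‖d‖ ^ 2 * ‖e‖ ^ 2 := by
    have := norm_pos_iff.2 hd
    have := norm_pos_iff.2 he
    positivity
  have h1 : absCos d e ^ 2 * (‖d‖ ^ 2 * ‖e‖ ^ 2) = inner ℝ d e ^ 2 := by
    rw [absCos, sq_abs, ← mul_pow, ← mul_pow, mul_comm (Real.cos _),
      mul_comm (‖d‖ * ‖e‖), InnerProductGeometry.cos_angle_mul_norm_mul_norm]
  have h2 := cross_sq_add_inner_sq d e
  have h3 : ρ ^ 2 ≤ 1 - absCos d e ^ 2 := by
    refine le_of_mul_le_mul_right ?_ hpos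
    linarith
  nlinarith [absCos_nonneg d e, absCos_le_one d e]

section Star

variable {K : Set Plane} {x₀ : Plane} {r : ℝ}

/-- The line through a segment contained in the boundary of a star-shaped domain does not meet the
ball with respect to which the domain is star-shaped. -/
lemma line_notMem_ball (hK : IsOpen K) (hball : Metric.ball x₀ r ⊆ K)
    (hstar : ∀ y ∈ Metric.ball x₀ r, StarConvex ℝ y K) {a b : Plane}
    (hab : segment ℝ a b ⊆ frontier K) (s : ℝ) : a + s • (b - a) ∉ Metric.ball x₀ r := by
  intro hy
  have hnot : ∀ x ∈ segment ℝ a b, x ∉ K := fun x hx hxK => by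
    have := hab hx
    rw [hK.frontier_eq] at this
    exact this.2 hxK
  have hcl : ∀ x ∈ segment ℝ a b, x ∈ closure K := fun x hx => frontier_subset_closure (hab hx)
  have ha := left_mem_segment ℝ a b
  have hb := right_mem_segment ℝ a b
  -- If the point of the ball lies beyond an endpoint, that endpoint is strictly closer to it than
  -- the other on the same line, hence in `K`. If it lies on the segment, it is itself in `K`. Both
  -- contradict being on the frontier of an open set.
  rcases lt_or_ge s 0 with hs | hs
  · refine hnot a ha ?_
    have := closure_segment_mem hstar (hcl b hb) hy (t := -s / (1 - s))
      (div_nonneg (by linarith) (by linarith)) ((div_lt_one (by linarith)).2 (by linarith))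
    have e : -s / (1 - s) * (1 - s) = -s := div_mul_cancel₀ _ (by linarith)
    convert this using 1
    calc a = a + s • (b - a) + (-s) • (b - a) := by module
      _ = a + s • (b - a) + (-s / (1 - s) * (1 - s)) • (b - a) := by rw [e]
      _ = _ := by module
  rcases le_or_gt s 1 with hs1 | hs1
  · refine hnot _ ?_ (hball hy)
    rw [segment_eq_image']
    exact ⟨s, ⟨hs, hs1⟩, rfl⟩
  · refine hnot b hb ?_
    have := closure_segment_mem hstar (hcl a ha) hy (t := (s - 1) / s)
      (div_nonneg (by linarith) (by linarith)) ((div_lt_one (by linarith)).2 (by linarith))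
    have e : (s - 1) / s * s = s - 1 := div_mul_cancel₀ _ (by linarith)
    convert this using 1
    calc b = a + s • (b - a) - (s - 1) • (b - a) := by module
      _ = a + s • (b - a) - ((s - 1) / s * s) • (b - a) := by rw [e]
      _ = _ := by module

/-- `|cross (q - x₀) (b - a)| / ‖b - a‖` is the distance from `x₀` to the line through the edge; the
foot of the perpendicular lies outside the ball. -/
lemma mul_norm_sq_le_cross_sq (hK : IsOpen K) (hr : 0 < r) (hball : Metric.ball x₀ r ⊆ K)
    (hstar : ∀ y ∈ Metric.ball x₀ r, StarConvex ℝ y K) {a b q : Plane} (hne : b - a ≠ 0)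
    (hab : segment ℝ a b ⊆ frontier K) (hq : q ∈ segment ℝ a b) :
    r ^ 2 * ‖b - a‖ ^ 2 ≤ cross (q - x₀) (b - a) ^ 2 := by
  rw [segment_eq_image'] at hq
  obtain ⟨s, -, rfl⟩ := hq
  set d := b - a with hd
  set z := a + s • d - x₀ with hz
  have hd0 : 0 < ‖d‖ ^ 2 := by have := norm_pos_iff.2 hne; positivity
  set σ := inner ℝ z d / ‖d‖ ^ 2 with hσ
  have h1 := line_notMem_ball hK hball hstar hab (s - σ)
  have h2 : a + (s - σ) • d - x₀ = z - σ • d := by rw [hz]; module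
  rw [mem_ball_iff_norm, not_lt, ← hd, h2] at h1
  have h3 : ‖z - σ • d‖ ^ 2 * ‖d‖ ^ 2 = cross z d ^ 2 := by
    have h4 := cross_sq_add_inner_sq (z - σ • d) d
    have h5 : inner ℝ (z - σ • d) d = 0 := by
      rw [inner_sub_left, real_inner_smul_left, real_inner_self_eq_norm_sq, hσ,
        div_mul_cancel₀ _ hd0.ne', sub_self]
    have h6 : cross (z - σ • d) d = cross z d := by simp [cross]; ring
    rw [← h4, h5, h6]; ring
  rw [← h3]
  gcongr

/-- Otherwise `K` and the complement of its closure would disconnect the line, which starts in `K`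
and leaves it by boundedness. -/
lemma exists_add_smul_mem_frontier (hK : IsOpen K) (hb : Bornology.IsBounded K) (hx₀ : x₀ ∈ K) {e : Plane}
    (he : e ≠ 0) : ∃ τ : ℝ, x₀ + τ • e ∈ frontier K := by
  obtain ⟨R, hR⟩ := hb.subset_ball x₀
  have he' := norm_pos_iff.2 he
  have hconn : IsPreconnected (range fun τ : ℝ => x₀ + τ • e) :=
    isPreconnected_range (by fun_prop)
  have hR0 : 0 < R := by simpa using (Metric.mem_ball.1 (hR hx₀))
  by_contra! hcon
  have hcase : ∀ τ : ℝ, x₀ + τ • e ∉ K → x₀ + τ • e ∉ closure K := fun τ h1 h2 => by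
    refine hcon τ ?_
    rw [hK.frontier_eq]
    exact ⟨h2, h1⟩
  have hout : x₀ + (R / ‖e‖) • e ∉ K := fun hmem => by
    have := hR hmem
    rw [mem_ball_iff_norm, add_sub_cancel_left, norm_smul, Real.norm_of_nonneg (by positivity),
      div_mul_cancel₀ _ he'.ne'] at this
    exact lt_irrefl _ this
  obtain ⟨z, -, hz, hz'⟩ := hconn K (closure K)ᶜ hK isClosed_closure.isOpen_compl
    (by rintro _ ⟨τ, rfl⟩
        by_cases hτ : x₀ + τ • e ∈ K
        · exact Or.inl hτ
        · exact Or.inr (hcase τ hτ))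
    ⟨x₀, ⟨0, by simp⟩, hx₀⟩ ⟨_, ⟨_, rfl⟩, hcase _ hout⟩
  exact hz' (subset_closure hz)

variable {n : ℕ} {P : Polygon Plane n} {ρ : ℝ}

/-- The `i`-th edge of a polygon, as a vector. -/
noncomputable def edgeVec (P : Polygon Plane n) (i : Fin n) : Plane := P (finRotate n i) - P i

lemma IsPolygonalDomain.edgeVec_ne_zero (h : IsPolygonalDomain P K) (i : Fin n) :
    edgeVec P i ≠ 0 := sub_ne_zero.2 (h.simple.nondegenerate i).symm

lemma IsPolygonalDomain.edgeSet_subset (h : IsPolygonalDomain P K) (i : Fin n) :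
    segment ℝ (P i) (P (finRotate n i)) ⊆ frontier K := by
  rw [h.frontier_eq, ← affineSegment_eq_segment]
  exact subset_iUnion (fun i => P.edgeSet ℝ i) i

lemma IsPolygonalDomain.mem_closure (h : IsPolygonalDomain P K) (i : Fin n) :
    P i ∈ closure K :=
  frontier_subset_closure (h.edgeSet_subset i (left_mem_segment ℝ _ _))

lemma IsPolygonalDomain.diam_pos (h : IsPolygonalDomain P K) : 0 < Metric.diam K := by
  have i : Fin n := ⟨0, by have := h.simple.three_le; omega⟩
  rw [← Metric.diam_closure]
  exact (dist_pos.2 (h.simple.nondegenerate i)).trans_le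
    (Metric.dist_le_diam_of_mem h.isBounded.closure (h.mem_closure _) (h.mem_closure _))

/-- Some edge of a star-shaped polygonal domain is transversal to a given direction. -/
lemma exists_transversal_edge (h : IsPolygonalDomain P K) (hρ : 0 < ρ)
    (hrh : ρ * Metric.diam K ≤ r) (hball : Metric.ball x₀ r ⊆ K)
    (hstar : ∀ y ∈ Metric.ball x₀ r, StarConvex ℝ y K) {e : Plane} (he : e ≠ 0) :
    ∃ j, ρ ^ 2 * (‖e‖ ^ 2 * ‖edgeVec P j‖ ^ 2) ≤ cross e (edgeVec P j) ^ 2 := by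
  have hdiam := h.diam_pos
  have hr : 0 < r := (mul_pos hρ hdiam).trans_le hrh
  have hx₀ : x₀ ∈ K := hball (Metric.mem_ball_self hr)
  -- The line through `x₀` along `e` hits an edge within distance `h`, while the line of that edge
  -- is at distance at least `ρ h` from `x₀`; so the sine between them is at least `ρ`.
  obtain ⟨τ, hτ⟩ := exists_add_smul_mem_frontier h.isOpen h.isBounded hx₀ he
  have hmem := hτ
  rw [h.frontier_eq] at hmem
  obtain ⟨j, hj⟩ := mem_iUnion.1 hmem
  rw [Polygon.edgeSet, affineSegment_eq_segment] at hj
  refine ⟨j, ?_⟩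
  have h1 := mul_norm_sq_le_cross_sq h.isOpen hr hball hstar (h.edgeVec_ne_zero j)
    (h.edgeSet_subset j) hj
  rw [add_sub_cancel_left, cross_smul_left] at h1
  have h2 : |τ| * ‖e‖ ≤ Metric.diam K := by
    have := Metric.dist_le_diam_of_mem h.isBounded.closure (frontier_subset_closure hτ)
      (subset_closure hx₀)
    rwa [Metric.diam_closure, dist_eq_norm, add_sub_cancel_left, norm_smul, Real.norm_eq_abs] at this
  change r ^ 2 * ‖edgeVec P j‖ ^ 2 ≤ (τ * cross e (edgeVec P j)) ^ 2 at h1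
  have h3 : τ ^ 2 * ‖e‖ ^ 2 ≤ Metric.diam K ^ 2 := by
    rw [← sq_abs τ, ← mul_pow]
    gcongr
  have h4 : (ρ * Metric.diam K) ^ 2 ≤ r ^ 2 := by gcongr
  refine le_of_mul_le_mul_left ?_ (by positivity : 0 < Metric.diam K ^ 2)
  calc Metric.diam K ^ 2 * (ρ ^ 2 * (‖e‖ ^ 2 * ‖edgeVec P j‖ ^ 2))
      = (ρ * Metric.diam K) ^ 2 * ‖edgeVec P j‖ ^ 2 * ‖e‖ ^ 2 := by ring
    _ ≤ r ^ 2 * ‖edgeVec P j‖ ^ 2 * ‖e‖ ^ 2 := by gcongr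
    _ ≤ (τ * cross e (edgeVec P j)) ^ 2 * ‖e‖ ^ 2 := by gcongr
    _ = τ ^ 2 * ‖e‖ ^ 2 * cross e (edgeVec P j) ^ 2 := by ring
    _ ≤ _ := by gcongr

lemma edgeVec_finRotate_of_collinear (h : IsPolygonalDomain P K) {i : Fin n}
    (hc : ¬ NoncollinearAt P i) : ∃ c : ℝ, edgeVec P (finRotate n i) = c • edgeVec P i := by
  rw [NoncollinearAt, not_not, collinear_iff_of_mem (p₀ := P i) (by simp)] at hc
  obtain ⟨v, hv⟩ := hc
  obtain ⟨a, ha⟩ := hv (P (finRotate n i)) (by simp)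
  obtain ⟨b, hb⟩ := hv (P (finRotate n (finRotate n i))) (by simp)
  rw [vadd_eq_add] at ha hb
  refine exists_eq_smul_of_cross_eq_zero (h.edgeVec_ne_zero i) ?_
  rw [edgeVec, edgeVec, ha, hb, show a • v + P i - P i = a • v by module,
    show b • v + P i - (a • v + P i) = (b - a) • v by module, cross_smul_left, cross_smul_right,
    cross_self]
  simp

/-- Every edge is parallel to the first edge at some vertex that is not straight. -/
lemma exists_noncollinearAt_parallel (h : IsPolygonalDomain P K) (hρ : 0 < ρ)
    (hrh : ρ * Metric.diam K ≤ r) (hball : Metric.ball x₀ r ⊆ K)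
    (hstar : ∀ y ∈ Metric.ball x₀ r, StarConvex ℝ y K) (j : Fin n) :
    ∃ i, NoncollinearAt P i ∧ ∃ c : ℝ, edgeVec P i = c • edgeVec P j := by
  -- Otherwise parallelism to edge `j` passes through every vertex reached and, around the cycle, to
  -- all edges, leaving none transversal to edge `j`.
  by_contra! hcon
  have hstep : ∀ i, (∃ c : ℝ, edgeVec P i = c • edgeVec P j) →
      ∃ c : ℝ, edgeVec P (finRotate n i) = c • edgeVec P j := by
    rintro i ⟨c, hc⟩
    obtain ⟨c', hc'⟩ := edgeVec_finRotate_of_collinear h fun hi => hcon i hi c hc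
    exact ⟨c' * c, by rw [hc', hc, smul_smul]⟩
  have hpow : ∀ k : ℕ, ∃ c : ℝ, edgeVec P ((finRotate n ^ k) j) = c • edgeVec P j := by
    intro k
    induction k with
    | zero => exact ⟨1, by simp⟩
    | succ k ih => rw [pow_succ']; exact hstep _ ih
  have hall : ∀ i, ∃ c : ℝ, edgeVec P i = c • edgeVec P j := by
    intro i
    have hn : 2 ≤ n := le_trans (by norm_num) h.simple.three_le
    have hs : ∀ k, finRotate n k ≠ k := fun k => by
      rw [← Equiv.Perm.mem_support, support_finRotate_of_le hn]; simp
    obtain ⟨k, hk⟩ := (isCycle_finRotate_of_le hn).exists_pow_eq (hs j) (hs i)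
    rw [← hk]
    exact hpow k
  obtain ⟨i, hi⟩ := exists_transversal_edge h hρ hrh hball hstar (h.edgeVec_ne_zero j)
  obtain ⟨c, hc⟩ := hall i
  have h0 := norm_pos_iff.2 (h.edgeVec_ne_zero i)
  have h1 := norm_pos_iff.2 (h.edgeVec_ne_zero j)
  have h2 : cross (edgeVec P j) (edgeVec P i) = 0 := by
    rw [hc, cross_smul_right, cross_self, mul_zero]
  rw [h2] at hi
  have : 0 < ρ ^ 2 * (‖edgeVec P j‖ ^ 2 * ‖edgeVec P i‖ ^ 2) := by positivity
  linarith

/-- Two edges that start at vertices that are not straight and that are uniformly transversal. -/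
lemma exists_transversal_noncollinearAt (h : IsPolygonalDomain P K) (hρ : 0 < ρ)
    (hrh : ρ * Metric.diam K ≤ r) (hball : Metric.ball x₀ r ⊆ K)
    (hstar : ∀ y ∈ Metric.ball x₀ r, StarConvex ℝ y K) :
    ∃ i j, NoncollinearAt P i ∧ NoncollinearAt P j ∧
      ρ ^ 2 / 2 ≤ 1 - absCos (edgeVec P i) (edgeVec P j) := by
  have i₀ : Fin n := ⟨0, by have := h.simple.three_le; omega⟩
  obtain ⟨i, hi, -⟩ := exists_noncollinearAt_parallel h hρ hrh hball hstar i₀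
  obtain ⟨k, hk⟩ := exists_transversal_edge h hρ hrh hball hstar (h.edgeVec_ne_zero i)
  obtain ⟨j, hj, c, hc⟩ := exists_noncollinearAt_parallel h hρ hrh hball hstar k
  refine ⟨i, j, hi, hj, absCos_le_of_cross (h.edgeVec_ne_zero i) (h.edgeVec_ne_zero j) ?_⟩
  rw [hc, cross_smul_right, norm_smul, mul_pow, mul_pow, Real.norm_eq_abs, sq_abs]
  calc ρ ^ 2 * (‖edgeVec P i‖ ^ 2 * (c ^ 2 * ‖edgeVec P k‖ ^ 2))
      = c ^ 2 * (ρ ^ 2 * (‖edgeVec P i‖ ^ 2 * ‖edgeVec P k‖ ^ 2)) := by ring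
    _ ≤ _ := by gcongr

/-- One edge vector enters the middle vertex and the other leaves it, so their angle is `π - θ`; the
absolute value hides the sign. -/
lemma absCos_edgeVec (P : Polygon Plane n) (i : Fin n) :
    absCos (edgeVec P i) (edgeVec P (finRotate n i)) = |Real.cos (angleAt P i)| := by
  rw [absCos, edgeVec, edgeVec, angleAt, EuclideanGeometry.angle, vsub_eq_sub, vsub_eq_sub,
    ← neg_sub (P i), InnerProductGeometry.angle_neg_left, Real.cos_pi_sub, abs_neg]

lemma abs_cos_angleAt_lt_one {i : Fin n} (h : NoncollinearAt P i) :
    |Real.cos (angleAt P i)| < 1 := by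
  refine lt_of_le_of_ne (Real.abs_cos_le_one _) fun hc => h ?_
  rw [EuclideanGeometry.collinear_iff_eq_or_eq_or_angle_eq_zero_or_angle_eq_pi]
  rcases eq_or_eq_neg_of_abs_eq hc with h1 | h1
  · exact Or.inr (Or.inr (Or.inl (InnerProductGeometry.cos_eq_one_iff_angle_eq_zero.1 h1)))
  · exact Or.inr (Or.inr (Or.inr (InnerProductGeometry.cos_eq_neg_one_iff_angle_eq_pi.1 h1)))

end Star

/-! ### Assembly of the two estimates -/

lemma seminormH1_le_of_sq {κ κ₀ A C s X : ℝ} (hκ₀ : 0 < κ₀) (hκ : κ₀ ≤ κ) (hC : 0 ≤ C)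
    (hX : 0 ≤ X) (hAC : A ≤ C ^ 2) (h : κ * s ^ 2 ≤ A * X ^ 2) : s ≤ C / √κ₀ * X := by
  refine le_of_sq_le_sq ?_ (by positivity)
  rw [mul_pow, div_pow, Real.sq_sqrt hκ₀.le, div_mul_eq_mul_div, le_div_iff₀ hκ₀]
  nlinarith [sq_nonneg s, sq_nonneg X, mul_le_mul_of_nonneg_right hκ (sq_nonneg s),
    mul_le_mul_of_nonneg_right hAC (sq_nonneg X)]

end Plane

theorem mainTheorem11 (ρ : ℝ) (hρ : 0 < ρ) :
    ∃ C : ℝ, 0 < C ∧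
      ∀ (n : ℕ) (P : Polygon Plane n) (K : Set Plane),
        Plane.IsPolygonalDomain P K → Plane.IsMeshRegular ρ P K →
        ∀ v w : Plane → ℝ, Plane.MemH K 2 v → Plane.IsContinuousRep K v w →
          ((∀ i : Fin n, Plane.NoncollinearAt P i → Plane.EqualValuesAt P w i) →
            Plane.seminormH1 K v ≤ C * Metric.diam K * Plane.seminormH2 K v) ∧
          (∀ i : Fin n, Plane.NoncollinearAt P i → Plane.EqualValuesAt P w i →
            Plane.seminormH1 K v ≤
              C / √(1 - |Real.cos (Plane.angleAt P i)|) *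
                Metric.diam K * Plane.seminormH2 K v) := by
  set A := 1 / ρ ^ 2 * (8 + 96 / ρ ^ 2) with hA
  have hA0 : 0 < A := by positivity
  -- The second summand serves part 1, where `1 - |cos| ≥ ρ² / 2`; the first serves part 2.
  refine ⟨√A + √A / √(ρ ^ 2 / 2), by positivity, ?_⟩
  intro n P K hP hmesh v w hv hw
  obtain ⟨x₀, r, hrh, hball, hstar⟩ := hmesh.starShaped
  have hdiam := hP.diam_pos
  have hX : 0 ≤ Metric.diam K * Plane.seminormH2 K v :=
    mul_nonneg hdiam.le (Real.sqrt_nonneg _)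
  have hlen : ∀ i, ρ * Metric.diam K ≤ ‖P (finRotate n i) - P i‖ := fun i => by
    rw [← dist_eq_norm, dist_comm]
    exact hmesh.edge_length i
  have hest : ∀ i j : Fin n, w (P i) = w (P (finRotate n i)) → w (P j) = w (P (finRotate n j)) →
      (1 - Plane.absCos (Plane.edgeVec P i) (Plane.edgeVec P j)) * Plane.seminormH1 K v ^ 2 ≤
        A * (Metric.diam K * Plane.seminormH2 K v) ^ 2 := fun i j hi hj =>
    Plane.mul_seminormH1_sq_le hρ hP.isOpen hP.isBounded hdiam hrh hball hstar hv hw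
      (p := ![P i, P (finRotate n i), P j, P (finRotate n j)])
      (fun k => by fin_cases k <;> exact hP.mem_closure _) (hlen i) (hlen j) hi hj
  refine ⟨fun heq => ?_, fun i hi heq => ?_⟩
  · obtain ⟨i, j, hi, hj, hij⟩ :=
      Plane.exists_transversal_noncollinearAt hP hρ hrh hball hstar
    have := Plane.seminormH1_le_of_sq (by positivity) hij (Real.sqrt_nonneg A) hX
      (Real.sq_sqrt hA0.le).ge (hest i j (heq i hi).1 (heq j hj).1)
    rw [mul_assoc]
    refine this.trans (mul_le_mul_of_nonneg_right ?_ hX)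
    linarith [Real.sqrt_nonneg A]
  · have hκ := sub_pos.2 (Plane.abs_cos_angleAt_lt_one hi)
    have h1 := hest i (finRotate n i) heq.1 heq.2
    rw [Plane.absCos_edgeVec] at h1
    have := Plane.seminormH1_le_of_sq hκ le_rfl (Real.sqrt_nonneg A) hX
      (Real.sq_sqrt hA0.le).ge h1
    rw [mul_assoc]
    refine this.trans (mul_le_mul_of_nonneg_right ?_ hX)
    gcongr
    exact le_add_of_nonneg_right (by positivity)
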